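/- Let $n\ge 4$ be even and $r\ge 2$. For $\varepsilon>0$ define $n\times 2$ matrices $V^\varepsilon,U,W$ with rows indexed by $i=0,\dots,n-1$: with $s_i=n-2-2i$, row $i$ of $V^\varepsilon$ is $(1-\varepsilon s_i^2,\ \varepsilon s_i)$ for even $i$, it is $\varepsilon(1-\varepsilon s_i^2,\ \varepsilon s_i)$ for odd $i\le n-3$, and $(-\varepsilon,0)$ for $i=n-1$; row $i$ of $U$ is $(0,1)$ for even $i$ and $(-3,-\tfrac23)$ for odd $i$; row $i$ of $W$ is $(-\tfrac{31}4,\tfrac12)$ for even $i$ and $(9,-\tfrac23)$ for odd $i$. Let $b_1\in\mathbb R^n$ have entries $1$ for even $i$ and $\varepsilon$ for odd $i$, and for $M>0$ put $b_k=M^{k-1}b_1$ $(1\le k\le r)$. Write $x=(x_1,\dots,x_r)\in(\mathbb R^2)^r=\mathbb R^{2r}$ and let $$P_n^{2r}=\{x\in\mathbb R^{2r}:\ W x_{k-2}+U x_{k-1}+V^\varepsilon x_k\le b_k\ \text{ for } k=1,\dots,r\},$$ where terms with index $\le 0$ are omitted. Let $C=\{y\in\mathbb R^2: V^\varepsilon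 y\le b_1\}$. A face $G$ of a polytope $P$ is strictly preserved by a linear projection $\pi$ if $\pi(G)$ is a face of $\pi(P)$, the map $G\to\pi(G)$ is a bijection, and $P\cap\pi^{-1}(\pi(G))=G$. Then for every sufficiently small $\varepsilon>0$ (depending on $n,r$) and every sufficiently large $M$ (depending on $n,r,\varepsilon$): 1. $C$ is a convex $n$-gon, and $P_n^{2r}$ is a $2r$-dimensional polytope. 2. $P_n^{2r}$ is combinatorially equivalent to the product $C^r$ of $r$ $n$-gons (its face lattice is isomorphic to that of $C^r$), by an isomorphism that takes, for all $k$ and $i$, the facet $\{y\in C^r:(V^\varepsilon y_k)_i=b_{1,i}\}$ to the facet of $P_n^{2r}$ on which the $i$-th inequality of the $k$-th block is tight. 3. The projection $\pi:\mathbb R^{2r}\to\mathbb R^4$ to the last four coordinates strictly preserves every vertex and every edge of $P_n^{2r}$, and every $2$-face of $P_n^{2r}$ that corresponds under this isomorphism to a product of one of the $n$-gons with a vertex from each of the other factors (the "$n$-gon $2$-faces"). -/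

import Mathlib

namespace ProjectedProducts

/-- The poset of all faces of a polytope `P` (including `∅` and `P`), ordered by inclusion: a face
is empty or the set of all maximizers over `P` of a linear functional. -/
abbrev Faces {E : Type*} [AddCommGroup E] [Module ℝ E] [TopologicalSpace E] (P : Set E) : Type _ :=
  {G : Set E // IsExposed ℝ P G}

/-- The (affine) dimension of a non-empty set. -/
noncomputable def dim {E : Type*} [AddCommGroup E] [Module ℝ E] (P : Set E) : ℕ :=
  Module.finrank ℝ (vectorSpan ℝ P)

/-- A `d`-dimensional polytope: a non-empty convex hull of finitely many points of dimension `d`. -/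
def IsPolytope {E : Type*} [AddCommGroup E] [Module ℝ E] (d : ℕ) (P : Set E) : Prop :=
  (∃ S : Set E, S.Finite ∧ P = convexHull ℝ S) ∧ P.Nonempty ∧ dim P = d

/-- A convex `n`-gon in the plane: the convex hull of `n` points in convex position. -/
def IsNGon (n : ℕ) (C : Set (Fin 2 → ℝ)) : Prop :=
  ∃ p : Fin n → Fin 2 → ℝ, ConvexIndependent ℝ p ∧ C = convexHull ℝ (Set.range p)

/-- The face `G` of the polytope `P` is strictly preserved by the linear projection `π`:
its image is a face of `π(P)`, the map `G → π(G)` is a bijection, and the preimage in `P` of the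
image is `G`. -/
def StrictlyPreserved {E F : Type*} [AddCommGroup E] [Module ℝ E]
    [AddCommGroup F] [Module ℝ F] [TopologicalSpace F]
    (π : E →ₗ[ℝ] F) (P G : Set E) : Prop :=
  IsExposed ℝ (π '' P) (π '' G) ∧ Set.BijOn π G (π '' G) ∧ P ∩ π ⁻¹' (π '' G) = G

/-- The block `V^ε` of size `n × 2`, rows indexed by `0, …, n - 1`. -/
noncomputable def blockV (n : ℕ) (ε : ℝ) : Matrix (Fin n) (Fin 2) ℝ := fun i =>
  let s : ℝ := (n : ℝ) - 2 - 2 * (i : ℕ)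
  if (i : ℕ) + 1 = n then ![-ε, 0]
  else if Even (i : ℕ) then ![1 - ε * s ^ 2, ε * s]
  else ![ε * (1 - ε * s ^ 2), ε * (ε * s)]

/-- The block `U` of size `n × 2`, with alternating rows. -/
noncomputable def blockU (n : ℕ) : Matrix (Fin n) (Fin 2) ℝ := fun i =>
  if Even (i : ℕ) then ![0, 1] else ![-3, -(2 / 3)]

/-- The block `W` of size `n × 2`, with alternating rows. -/
noncomputable def blockW (n : ℕ) : Matrix (Fin n) (Fin 2) ℝ := fun i =>
  if Even (i : ℕ) then ![-(31 / 4), 1 / 2] else ![9, -(2 / 3)]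

/-- The right-hand side `b₁`. -/
noncomputable def rhs (n : ℕ) (ε : ℝ) : Fin n → ℝ := fun i =>
  if Even (i : ℕ) then 1 else ε

/-- The `rn × 2r` coefficient matrix, with rows grouped into `r` blocks of `n` rows and columns
into `r` blocks of two columns: blocks `V^ε` on the diagonal, `U` on the first and `W` on the
second subdiagonal, zero elsewhere. -/
noncomputable def coeff (n r : ℕ) (ε : ℝ) : Matrix (Fin r × Fin n) (Fin (2 * r)) ℝ := fun ki c =>
  let k : ℕ := ki.1
  let j : ℕ := (c : ℕ) / 2
  let t : Fin 2 := ⟨(c : ℕ) % 2, Nat.mod_lt _ Nat.two_pos⟩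
  if k = j then blockV n ε ki.2 t
  else if k = j + 1 then blockU n ki.2 t
  else if k = j + 2 then blockW n ki.2 t
  else 0

/-- The `n`-gon `{y ∈ ℝ² : V^ε y ≤ b₁}`. -/
def polygon (n : ℕ) (ε : ℝ) : Set (Fin 2 → ℝ) :=
  {y | ∀ i, (blockV n ε).mulVec y i ≤ rhs n ε i}

/-- The product of `r` copies of the polygon. -/
def product (n r : ℕ) (ε : ℝ) : Set (Fin r → Fin 2 → ℝ) :=
  Set.univ.pi fun _ => polygon n ε

/-- The facet of the product given by edge `i` of its `k`-th factor. -/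
def productFacet (n r : ℕ) (ε : ℝ) (k : Fin r) (i : Fin n) : Set (Fin r → Fin 2 → ℝ) :=
  {y ∈ product n r ε | (blockV n ε).mulVec (y k) i = rhs n ε i}

/-- The face of the product that is the `k`-th polygon times a vertex `p j` of each other factor. -/
def productPolygon (n r : ℕ) (ε : ℝ) (k : Fin r) (p : Fin r → Fin 2 → ℝ) :
    Set (Fin r → Fin 2 → ℝ) :=
  {y | y k ∈ polygon n ε ∧ ∀ j, j ≠ k → y j = p j}

/-- The deformed product: the `k`-th block of rows (`k = 0, …, r - 1`) has right-hand side
`M ^ k • b₁`. -/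
def deformedProduct (n r : ℕ) (ε M : ℝ) : Set (Fin (2 * r) → ℝ) :=
  {x | ∀ ki : Fin r × Fin n, (coeff n r ε).mulVec x ki ≤ M ^ (ki.1 : ℕ) * rhs n ε ki.2}

/-- The facet of the deformed product given by row `i` of the `k`-th block of rows. -/
def deformedFacet (n r : ℕ) (ε M : ℝ) (k : Fin r) (i : Fin n) : Set (Fin (2 * r) → ℝ) :=
  {x ∈ deformedProduct n r ε M | (coeff n r ε).mulVec x (k, i) = M ^ (k : ℕ) * rhs n ε i}

/-- The projection `ℝ^{2r} → ℝ⁴` to the last four coordinates. -/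
def lastFour (r : ℕ) (hr : 2 ≤ r) : (Fin (2 * r) → ℝ) →ₗ[ℝ] (Fin 4 → ℝ) :=
  LinearMap.funLeft ℝ ℝ fun j : Fin 4 => (⟨2 * r - 4 + j, by omega⟩ : Fin (2 * r))

end ProjectedProducts

/-!
The deformed product is compared with the product of polygons through *active sets*: the sets of
inequalities that are tight at some point. The non-empty faces of a polyhedron `a i x ≤ b i` are the
sets `face a b J` with `J` active, so two polyhedra with the same active sets have isomorphic face
lattices (`facesIso`), facets corresponding to facets with the same label.

Combinatorial type. Along the parameter `s` the slack of a point in the inequalities of the polygon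
is a quadratic polynomial; hence inequalities tight at a common point are cyclically adjacent
(`adjacent_of_active`). So the polygon is simple, each of its vertices lies on one even and one odd
edge, and by compactness its active sets do not change when the right-hand side is perturbed a
little (`eventually_activeSets_eq`). The coefficient matrix is block triangular: once the earlier
blocks of `x` are fixed, the `k`-th block runs through a polygon with the normals of `V^ε` whose
right-hand side is, after division by `M ^ k`, as close to `b₁` as desired for large `M`. Choosing
the blocks one after the other shows that the deformed product has the active sets of the product
(`exists_forall_activeSets_eq`).

Projection. A face is strictly preserved if the normals of its tight inequalities, restricted to the
kernel of the projection, positively span the dual of the kernel (`strictlyPreserved_face`): the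
coefficients of a positive linear dependence define a functional that factors through the projection
and exposes exactly this face. For polygon faces, edges and vertices, one even and one odd row are
tight in every block but one, say the `k₀`-th. For `ε → 0` the rows depend only on their parity, and
the linear dependences of the truncated rows are solutions of a linear recurrence with
characteristic roots `1/2`, `1`, `2`. With `u = 2 ^ (k - k₀)` the coefficients `(u - 1) ^ 2 / u` for
the even and `(u - 1) * (u - 5 / 4) / u` for the odd rows vanish at `k₀` and are positive elsewhere;
since the rows have only a trivial common zero, they positively span
(`eq_zero_of_limit_rows_nonpos`). This is an open condition, so it persists for small `ε`
(`eventually_exists_coeffRow_pos`).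
-/

open Filter Topology

namespace ProjectedProducts

/-! ### Polyhedra, active inequalities and faces -/

section Polyhedron

variable {ι E : Type*} [AddCommGroup E] [Module ℝ E]

/-- The polyhedron cut out by the inequalities `a i x ≤ b i`. -/
def polyhedron (a : ι → E →ₗ[ℝ] ℝ) (b : ι → ℝ) : Set E := {x | ∀ i, a i x ≤ b i}

/-- The set of (indices of) inequalities of the system `a i x ≤ b i` that are tight at `x`. -/
def active (a : ι → E →ₗ[ℝ] ℝ) (b : ι → ℝ) (x : E) : Set ι := {i | a i x = b i}

/-- The part of the polyhedron on which all inequalities of `J` are tight. -/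
def face (a : ι → E →ₗ[ℝ] ℝ) (b : ι → ℝ) (J : Set ι) : Set E :=
  {x ∈ polyhedron a b | J ⊆ active a b x}

/-- The sets of inequalities that are exactly the tight ones at some point of the polyhedron. For
a polytope these encode the face lattice. -/
def activeSets (a : ι → E →ₗ[ℝ] ℝ) (b : ι → ℝ) : Set (Set ι) :=
  active a b '' polyhedron a b

theorem convex_polyhedron (a : ι → E →ₗ[ℝ] ℝ) (b : ι → ℝ) : Convex ℝ (polyhedron a b) := by
  have : polyhedron a b = ⋂ i, {x | a i x ≤ b i} := by
    ext x; simp [polyhedron]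
  rw [this]
  exact convex_iInter fun i => convex_halfSpace_le (a i).isLinear _

theorem lt_of_notMem_active {a : ι → E →ₗ[ℝ] ℝ} {b : ι → ℝ} {x : E} (hx : x ∈ polyhedron a b)
    {i : ι} (hi : i ∉ active a b x) : a i x < b i :=
  lt_of_le_of_ne (hx i) hi

theorem eventually_lt_of_notMem_active [Finite ι] {a : ι → E →ₗ[ℝ] ℝ} {b : ι → ℝ} {x : E}
    (hx : x ∈ polyhedron a b) (d : E) :
    ∀ᶠ t in 𝓝 (0 : ℝ), ∀ i, i ∉ active a b x → a i (x + t • d) < b i := by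
  rw [eventually_all]
  intro i
  by_cases hi : i ∈ active a b x
  · exact Eventually.of_forall fun t h => absurd hi h
  · have hc : Continuous fun t : ℝ => a i x + t * a i d := by fun_prop
    have h0 : a i x + (0 : ℝ) * a i d < b i := by
      simpa using lt_of_notMem_active hx hi
    filter_upwards [hc.continuousAt.eventually_lt continuousAt_const h0] with t ht _
    simpa using ht

/-- A direction along which all tight inequalities stay satisfied can be followed for some positive
time. -/
theorem exists_pos_add_smul_mem [Finite ι] {a : ι → E →ₗ[ℝ] ℝ} {b : ι → ℝ} {x : E}
    (hx : x ∈ polyhedron a b) {d : E} (hd : ∀ i ∈ active a b x, a i d ≤ 0) :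
    ∃ t : ℝ, 0 < t ∧ x + t • d ∈ polyhedron a b := by
  have h1 := (eventually_lt_of_notMem_active hx d).filter_mono
    (nhdsWithin_le_nhds (s := Set.Ioi 0))
  obtain ⟨t, ht, htpos⟩ := (h1.and self_mem_nhdsWithin).exists
  refine ⟨t, htpos, fun i => ?_⟩
  by_cases hi : i ∈ active a b x
  · have h2 : a i x = b i := hi
    have h3 : t * a i d ≤ 0 := mul_nonpos_of_nonneg_of_nonpos (le_of_lt htpos) (hd i hi)
    simp only [map_add, map_smul, smul_eq_mul]
    linarith
  · exact (ht i hi).le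

theorem mem_active_add_smul {a : ι → E →ₗ[ℝ] ℝ} {b : ι → ℝ} {x d : E} {i : ι}
    (hi : i ∈ active a b x) (hd : a i d = 0) (t : ℝ) : i ∈ active a b (x + t • d) := by
  simpa [active, hd] using hi

/-- At an extreme point the normals of the tight inequalities span the dual space. -/
theorem eq_zero_of_mem_extremePoints [Finite ι] {a : ι → E →ₗ[ℝ] ℝ} {b : ι → ℝ} {x : E}
    (hx : x ∈ (polyhedron a b).extremePoints ℝ) {d : E} (hd : ∀ i ∈ active a b x, a i d = 0) :
    d = 0 := by
  obtain ⟨t, ht, h1⟩ := exists_pos_add_smul_mem hx.1 (d := d) fun i hi => (hd i hi).le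
  obtain ⟨u, hu, h2⟩ := exists_pos_add_smul_mem hx.1 (d := -d) fun i hi => by simp [hd i hi]
  have h3 : x ∈ openSegment ℝ (x + t • d) (x + u • -d) := by
    refine ⟨u / (t + u), t / (t + u), by positivity, by positivity, by field_simp; ring, ?_⟩
    have h4 : u / (t + u) + t / (t + u) = 1 := by field_simp; ring
    have h5 : u / (t + u) * t - t / (t + u) * u = 0 := by ring
    calc (u / (t + u)) • (x + t • d) + (t / (t + u)) • (x + u • -d)
        = (u / (t + u) + t / (t + u)) • x + (u / (t + u) * t - t / (t + u) * u) • d := by module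
      _ = x := by rw [h4, h5]; simp
  have h6 := ((mem_extremePoints.1 hx).2 _ h1 _ h2 h3).1
  have h7 : t • d = 0 := by simpa using h6
  exact (smul_eq_zero.1 h7).resolve_left ht.ne'

/-- A point at which the normals of the tight inequalities span the dual space is extreme. -/
theorem mem_extremePoints_of_active {a : ι → E →ₗ[ℝ] ℝ} {b : ι → ℝ} {x : E}
    (hx : x ∈ polyhedron a b) (h : ∀ d, (∀ i ∈ active a b x, a i d = 0) → d = 0) :
    x ∈ (polyhedron a b).extremePoints ℝ := by
  refine mem_extremePoints.2 ⟨hx, ?_⟩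
  rintro x₁ h1 x₂ h2 ⟨p, q, hp, hq, hpq, rfl⟩
  have key : x₁ - x₂ = 0 := by
    refine h _ fun i hi => ?_
    have e : p * a i x₁ + q * a i x₂ = b i := by simpa [active] using hi
    have l1 := h1 i
    have l2 := h2 i
    have e1 : a i x₁ = b i := by
      have hb : b i = p * b i + q * b i := by rw [← add_mul, hpq, one_mul]
      nlinarith [mul_le_mul_of_nonneg_left l2 hq.le, mul_le_mul_of_nonneg_left l1 hp.le]
    have e2 : a i x₂ = b i := by
      have hb : b i = p * b i + q * b i := by rw [← add_mul, hpq, one_mul]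
      nlinarith [mul_le_mul_of_nonneg_left l2 hq.le, mul_le_mul_of_nonneg_left l1 hp.le]
    simp [e1, e2]
  have e : x₁ = x₂ := sub_eq_zero.1 key
  subst e
  simp [← add_smul, hpq]

theorem injOn_active_extremePoints [Finite ι] (a : ι → E →ₗ[ℝ] ℝ) (b : ι → ℝ) :
    Set.InjOn (active a b) ((polyhedron a b).extremePoints ℝ) := by
  intro x hx y hy hxy
  have := eq_zero_of_mem_extremePoints hx (d := x - y) fun i hi => by
    have h1 : a i x = b i := hi
    have h2 : a i y = b i := by rw [hxy] at hi; exact hi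
    simp [h1, h2]
  exact sub_eq_zero.1 this

theorem finite_extremePoints [Finite ι] (a : ι → E →ₗ[ℝ] ℝ) (b : ι → ℝ) :
    ((polyhedron a b).extremePoints ℝ).Finite :=
  Set.Finite.of_finite_image (Set.toFinite _) (injOn_active_extremePoints a b)

theorem mem_vectorSpan_face [Finite ι] {a : ι → E →ₗ[ℝ] ℝ} {b : ι → ℝ} {x : E}
    (hx : x ∈ polyhedron a b) {d : E} (hd : ∀ i ∈ active a b x, a i d = 0) :
    d ∈ vectorSpan ℝ (face a b (active a b x)) := by
  obtain ⟨t, ht, h⟩ := exists_pos_add_smul_mem hx fun i hi => (hd i hi).le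
  have h1 : x + t • d ∈ face a b (active a b x) :=
    ⟨h, fun i hi => mem_active_add_smul hi (hd i hi) t⟩
  have h2 := vsub_mem_vectorSpan ℝ h1 (⟨hx, subset_rfl⟩ : x ∈ face a b (active a b x))
  have h3 : t • d ∈ vectorSpan ℝ (face a b (active a b x)) := by simpa using h2
  exact (Submodule.smul_mem_iff _ ht.ne').1 h3

variable {E' : Type*} [AddCommGroup E'] [Module ℝ E']

/-- The set of points of the polyhedron of `a', b'` that have the same tight inequalities as some
point of `G`, a subset of the polyhedron of `a, b`. -/
def transfer (a : ι → E →ₗ[ℝ] ℝ) (b : ι → ℝ) (a' : ι → E' →ₗ[ℝ] ℝ) (b' : ι → ℝ) (G : Set E) :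
    Set E' :=
  {x ∈ polyhedron a' b' | ∃ y ∈ G, active a' b' x = active a b y}

variable {a : ι → E →ₗ[ℝ] ℝ} {b : ι → ℝ} {a' : ι → E' →ₗ[ℝ] ℝ} {b' : ι → ℝ}

theorem transfer_face (h : activeSets a b = activeSets a' b') (J : Set ι) :
    transfer a b a' b' (face a b J) = face a' b' J := by
  ext x
  constructor
  · rintro ⟨hx, y, hy, hxy⟩
    exact ⟨hx, hxy ▸ hy.2⟩
  · rintro ⟨hx, hJ⟩
    have h1 : active a' b' x ∈ activeSets a b := h ▸ ⟨x, hx, rfl⟩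
    obtain ⟨y, hy, hxy⟩ := h1
    exact ⟨hx, y, ⟨hy, hxy ▸ hJ⟩, hxy.symm⟩

theorem transfer_mono {G H : Set E} (h : G ⊆ H) :
    transfer a b a' b' G ⊆ transfer a b a' b' H :=
  fun _ hx => ⟨hx.1, let ⟨y, hy, e⟩ := hx.2; ⟨y, h hy, e⟩⟩

end Polyhedron

section Topology

variable {ι E : Type*} [NormedAddCommGroup E] [NormedSpace ℝ E]

/-- A non-empty face of a polyhedron is described by the inequalities tight at one of its relative
interior points. -/
theorem exists_eq_face [Finite ι] {a : ι → E →ₗ[ℝ] ℝ} {b : ι → ℝ} {G : Set E}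
    (hG : IsExposed ℝ (polyhedron a b) G) (hne : G.Nonempty) :
    ∃ x ∈ polyhedron a b, G = face a b (active a b x) := by
  classical
  have hconv := hG.convex (convex_polyhedron a b)
  obtain ⟨x, hxG, hxmin⟩ := exists_minimalFor_of_wellFoundedLT (fun x => x ∈ G)
    (fun x => (active a b x).ncard) hne
  have hsub : G ⊆ polyhedron a b := hG.subset
  -- the midpoint of `x` and `y` has only the common tight inequalities, so minimality applies
  have hact : ∀ y ∈ G, active a b x ⊆ active a b y := by
    intro y hy
    have hz : (1 / 2 : ℝ) • x + (1 / 2 : ℝ) • y ∈ G :=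
      hconv hxG hy (by norm_num) (by norm_num) (by norm_num)
    have hboth : ∀ i ∈ active a b ((1 / 2 : ℝ) • x + (1 / 2 : ℝ) • y),
        i ∈ active a b x ∧ i ∈ active a b y := by
      intro i hi
      have h1 : 1 / 2 * a i x + 1 / 2 * a i y = b i := by simpa [active] using hi
      have h2 := hsub hxG i
      have h3 := hsub hy i
      exact ⟨show a i x = b i by linarith, show a i y = b i by linarith⟩
    have hle := hxmin hz (Set.ncard_le_ncard fun i hi => (hboth i hi).1)
    have heq := Set.eq_of_subset_of_ncard_le (fun i hi => (hboth i hi).1) hle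
    exact fun i hi => (hboth i (heq ▸ hi)).2
  refine ⟨x, hsub hxG, Set.Subset.antisymm (fun y hy => ⟨hsub hy, hact y hy⟩) ?_⟩
  rintro y ⟨hy, hyact⟩
  obtain ⟨l, hl⟩ := hG hne
  rw [hl] at hxG ⊢
  obtain ⟨t, ht, hmem⟩ := exists_pos_add_smul_mem hxG.1 (d := x - y) fun i hi => by
    have h1 : a i x = b i := hi
    have h2 : a i y = b i := hyact hi
    simp [h1, h2]
  have h1 := hxG.2 _ hmem
  simp only [map_add, map_smul, map_sub, smul_eq_mul] at h1
  have h2 : l x ≤ l y := by nlinarith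
  exact ⟨hy, fun z hz => (hxG.2 z hz).trans h2⟩

theorem isExposed_face [Finite ι] [FiniteDimensional ℝ E] (a : ι → E →ₗ[ℝ] ℝ) (b : ι → ℝ)
    (J : Set ι) :
    IsExposed ℝ (polyhedron a b) (face a b J) := by
  classical
  have := Fintype.ofFinite ι
  rintro ⟨x₀, hx₀, hJ⟩
  refine ⟨LinearMap.toContinuousLinearMap (∑ i ∈ J.toFinite.toFinset, a i), ?_⟩
  ext x
  simp only [LinearMap.coe_toContinuousLinearMap', LinearMap.sum_apply, Set.mem_ofPred_eq]
  constructor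
  · rintro ⟨hx, h⟩
    refine ⟨hx, fun y hy => Finset.sum_le_sum fun i hi => ?_⟩
    have : a i x = b i := h (by simpa using hi)
    exact this ▸ hy i
  · rintro ⟨hx, h⟩
    refine ⟨hx, fun i hi => ?_⟩
    have h1 := h x₀ hx₀
    have h2 : ∑ i ∈ J.toFinite.toFinset, a i x₀ = ∑ i ∈ J.toFinite.toFinset, b i :=
      Finset.sum_congr rfl fun i hi => hJ (by simpa using hi)
    rw [h2] at h1
    have h3 := (Finset.sum_eq_sum_iff_of_le fun i _ => hx i).1
      (le_antisymm (Finset.sum_le_sum fun i _ => hx i) h1)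
    exact h3 i (by simpa using hi)

/-! ### Polyhedra with the same active sets -/

section Iso

variable {E' : Type*} [NormedAddCommGroup E'] [NormedSpace ℝ E']

variable {a : ι → E →ₗ[ℝ] ℝ} {b : ι → ℝ} {a' : ι → E' →ₗ[ℝ] ℝ} {b' : ι → ℝ}

theorem isExposed_transfer [Finite ι] [FiniteDimensional ℝ E']
    (h : activeSets a b = activeSets a' b') {G : Set E}
    (hG : IsExposed ℝ (polyhedron a b) G) :
    IsExposed ℝ (polyhedron a' b') (transfer a b a' b' G) := by
  rcases G.eq_empty_or_nonempty with rfl | hne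
  · have : transfer a b a' b' (∅ : Set E) = ∅ := by simp [transfer]
    rw [this]
    exact isExposed_empty
  · obtain ⟨x, -, rfl⟩ := exists_eq_face hG hne
    rw [transfer_face h]
    exact isExposed_face _ _ _

theorem transfer_transfer [Finite ι] (h : activeSets a b = activeSets a' b') {G : Set E}
    (hG : IsExposed ℝ (polyhedron a b) G) :
    transfer a' b' a b (transfer a b a' b' G) = G := by
  rcases G.eq_empty_or_nonempty with rfl | hne
  · simp [transfer]
  · obtain ⟨x, -, rfl⟩ := exists_eq_face hG hne
    rw [transfer_face h, transfer_face h.symm]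

/-- Two polyhedra with the same active sets have isomorphic face lattices. -/
def facesIso [Finite ι] [FiniteDimensional ℝ E] [FiniteDimensional ℝ E']
    (h : activeSets a b = activeSets a' b') :
    Faces (polyhedron a b) ≃o Faces (polyhedron a' b') where
  toFun G := ⟨transfer a b a' b' G.1, isExposed_transfer h G.2⟩
  invFun G := ⟨transfer a' b' a b G.1, isExposed_transfer h.symm G.2⟩
  left_inv G := Subtype.ext (transfer_transfer h G.2)
  right_inv G := Subtype.ext (transfer_transfer h.symm G.2)
  map_rel_iff' {G H} := by
    refine ⟨fun hGH => ?_, fun hGH => transfer_mono hGH⟩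
    have h0 : transfer a b a' b' G.1 ⊆ transfer a b a' b' H.1 := hGH
    have h1 := transfer_mono (a := a') (b := b') (a' := a) (b' := b) h0
    rwa [transfer_transfer h G.2, transfer_transfer h H.2] at h1

theorem facesIso_face [Finite ι] [FiniteDimensional ℝ E] [FiniteDimensional ℝ E']
    (h : activeSets a b = activeSets a' b') (J : Set ι) :
    (facesIso h ⟨face a b J, isExposed_face a b J⟩ : Set E') = face a' b' J :=
  transfer_face h J

end Iso

/-! ### Boundedness -/

variable [FiniteDimensional ℝ E]

theorem isClosed_polyhedron (a : ι → E →ₗ[ℝ] ℝ) (b : ι → ℝ) : IsClosed (polyhedron a b) := by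
  have : polyhedron a b = ⋂ i, {x | a i x ≤ b i} := by
    ext x; simp [polyhedron]
  rw [this]
  exact isClosed_iInter fun i =>
    isClosed_le (a i).continuous_of_finiteDimensional continuous_const

theorem polyhedron_eq_convexHull_extremePoints [Finite ι] {a : ι → E →ₗ[ℝ] ℝ} {b : ι → ℝ}
    (hb : Bornology.IsBounded (polyhedron a b)) :
    polyhedron a b = convexHull ℝ ((polyhedron a b).extremePoints ℝ) := by
  have hc : IsCompact (polyhedron a b) :=
    Metric.isCompact_of_isClosed_isBounded (isClosed_polyhedron a b) hb
  have h := closure_convexHull_extremePoints hc (convex_polyhedron a b)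
  rw [((finite_extremePoints a b).isClosed_convexHull ℝ).closure_eq] at h
  exact h.symm

/-! ### Strict preservation -/

/-- Compactness of the unit sphere makes "for every `y ≠ 0` in `K` some `f i y` is positive"
quantitative. -/
theorem exists_pos_mul_norm_le [Finite ι] (f : ι → E →ₗ[ℝ] ℝ) (K : Submodule ℝ E)
    (h : ∀ y ∈ K, y ≠ 0 → ∃ i, 0 < f i y) :
    ∃ δ > 0, ∀ y ∈ K, y ≠ 0 → ∃ i, δ * ‖y‖ ≤ f i y := by
  have := Fintype.ofFinite ι
  have hK : IsCompact (Metric.sphere (0 : E) 1 ∩ K) :=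
    (isCompact_sphere 0 1).inter_right K.closed_of_finiteDimensional
  have hcont : Continuous fun y => ∑ i, max (f i y) 0 :=
    continuous_finsetSum _ fun i _ =>
      ((f i).continuous_of_finiteDimensional).max continuous_const
  have hpos : ∀ y ∈ Metric.sphere (0 : E) 1 ∩ K, 0 < ∑ i, max (f i y) 0 := by
    rintro y ⟨hy, hyK⟩
    obtain ⟨i, hi⟩ := h y hyK (by rintro rfl; simp at hy)
    exact Finset.sum_pos' (fun j _ => le_max_right _ _) ⟨i, Finset.mem_univ _, lt_max_of_lt_left hi⟩
  obtain ⟨m, hm, hmin⟩ : ∃ m > 0, ∀ y ∈ Metric.sphere (0 : E) 1 ∩ K, m ≤ ∑ i, max (f i y) 0 := by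
    rcases (Metric.sphere (0 : E) 1 ∩ K).eq_empty_or_nonempty with he | hne
    · exact ⟨1, one_pos, by simp [he]⟩
    · obtain ⟨x, hx, hmin⟩ := hK.exists_isMinOn hne hcont.continuousOn
      exact ⟨_, hpos x hx, fun y hy => hmin hy⟩
  have hN : (0 : ℝ) < Fintype.card ι + 1 := by positivity
  refine ⟨m / (Fintype.card ι + 1), by positivity, fun y hy hy0 => ?_⟩
  by_contra! hcon
  have hny : 0 < ‖y‖ := norm_pos_iff.2 hy0
  have h1 := hmin (‖y‖⁻¹ • y) ⟨by simp [norm_smul, hny.ne'], K.smul_mem _ hy⟩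
  have h2 : ∑ i, max (f i (‖y‖⁻¹ • y)) 0 ≤ ∑ _i : ι, m / (Fintype.card ι + 1) := by
    refine Finset.sum_le_sum fun i _ => max_le ?_ (by positivity)
    have := (hcon i).le
    rw [map_smul, smul_eq_mul, inv_mul_le_iff₀ hny, mul_comm]
    exact this
  have h3 : ∑ _i : ι, m / ((Fintype.card ι : ℝ) + 1) < m := by
    rw [Finset.sum_const, Finset.card_univ, nsmul_eq_mul, ← mul_div_assoc, div_lt_iff₀ hN]
    nlinarith
  linarith

/-- A polyhedron whose recession cone is trivial is bounded, uniformly in bounded right-hand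
sides. -/
theorem exists_norm_le_of_mem_polyhedron [Finite ι] (a : ι → E →ₗ[ℝ] ℝ)
    (h : ∀ y ≠ 0, ∃ i, 0 < a i y) (B : ℝ) :
    ∃ R : ℝ, ∀ c : ι → ℝ, (∀ i, c i ≤ B) → ∀ y ∈ polyhedron a c, ‖y‖ ≤ R := by
  obtain ⟨δ, hδ, hy⟩ := exists_pos_mul_norm_le a ⊤ fun y _ => h y
  refine ⟨max 0 (B / δ), fun c hc y hyc => ?_⟩
  by_cases h0 : y = 0
  · simp [h0]
  · obtain ⟨i, hi⟩ := hy y trivial h0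
    refine le_max_of_le_right ?_
    rw [le_div_iff₀ hδ, mul_comm]
    exact hi.trans ((hyc i).trans (hc i))

/-- Stiemke's alternative: if no `y ≠ 0` in `K` has `f i y ≤ 0` for all `i`, then the `f i` satisfy
a strictly positive linear relation on `K`. The coefficients are read off at a minimum of the
coercive function `∑ i, exp (f i y)`. -/
theorem exists_pos_sum_eq_zero [Fintype ι] (f : ι → E →ₗ[ℝ] ℝ) (K : Submodule ℝ E)
    (h : ∀ y ∈ K, y ≠ 0 → ∃ i, 0 < f i y) :
    ∃ c : ι → ℝ, (∀ i, 0 < c i) ∧ ∀ y ∈ K, ∑ i, c i * f i y = 0 := by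
  obtain ⟨δ, hδ, hy⟩ := exists_pos_mul_norm_le f K h
  set F : E → ℝ := fun y => ∑ i, Real.exp (f i y) with hF
  have hcont : Continuous F := continuous_finsetSum _ fun i _ =>
    Real.continuous_exp.comp (f i).continuous_of_finiteDimensional
  have hR : ∀ y ∈ K, F y ≤ F 0 → ‖y‖ ≤ F 0 / δ := by
    intro y hyK hle
    by_cases h0 : y = 0
    · rw [h0, norm_zero]
      exact div_nonneg (Finset.sum_nonneg fun i _ => (Real.exp_pos _).le) hδ.le
    · obtain ⟨i, hi⟩ := hy y hyK h0
      have h1 : Real.exp (f i y) ≤ F y :=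
        Finset.single_le_sum (f := fun i => Real.exp (f i y)) (fun i _ => (Real.exp_pos _).le)
          (Finset.mem_univ i)
      have h2 := Real.add_one_le_exp (f i y)
      rw [le_div_iff₀ hδ]
      linarith
  have hK : IsCompact (Metric.closedBall (0 : E) (F 0 / δ) ∩ K) :=
    (isCompact_closedBall 0 _).inter_right K.closed_of_finiteDimensional
  have h0mem : (0 : E) ∈ Metric.closedBall (0 : E) (F 0 / δ) ∩ K :=
    ⟨by simpa using hR 0 K.zero_mem le_rfl, K.zero_mem⟩
  obtain ⟨x, hx, hmin⟩ := hK.exists_isMinOn ⟨0, h0mem⟩ hcont.continuousOn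
  have hmin' : ∀ y ∈ K, F x ≤ F y := by
    intro y hyK
    by_cases hle : F y ≤ F 0
    · exact hmin ⟨by simpa using hR y hyK hle, hyK⟩
    · exact (hmin h0mem).trans (not_le.1 hle).le
  refine ⟨fun i => Real.exp (f i x), fun i => Real.exp_pos _, fun y hyK => ?_⟩
  have hd : HasDerivAt (fun t : ℝ => F (x + t • y)) (∑ i, Real.exp (f i x) * f i y) 0 := by
    refine HasDerivAt.fun_sum fun i _ => ?_
    have h1 : HasDerivAt (fun t : ℝ => f i (x + t • y)) (f i y) 0 := by
      have h2 : (fun t : ℝ => f i (x + t • y)) = fun t => f i x + t * f i y := by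
        ext t; simp
      rw [h2]
      simpa using ((hasDerivAt_id (0 : ℝ)).mul_const (f i y)).const_add (f i x)
    simpa using h1.exp
  refine IsLocalMin.hasDerivAt_eq_zero (Eventually.of_forall fun t => ?_) hd
  simpa using hmin' _ (K.add_mem hx.2 (K.smul_mem t hyK))

/-- A face is strictly preserved as soon as the normals of its tight inequalities, restricted to
the kernel of the projection, positively span the dual of the kernel. -/
theorem strictlyPreserved_face [Finite ι] {F : Type*} [NormedAddCommGroup F] [NormedSpace ℝ F]
    [FiniteDimensional ℝ F] (π : E →ₗ[ℝ] F) (a : ι → E →ₗ[ℝ] ℝ) (b : ι → ℝ) (J : Set ι)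
    (hne : (face a b J).Nonempty)
    (h : ∀ y, π y = 0 → y ≠ 0 → ∃ i ∈ J, 0 < a i y) :
    StrictlyPreserved π (polyhedron a b) (face a b J) := by
  classical
  have := Fintype.ofFinite ι
  obtain ⟨c, hc, hsum⟩ := exists_pos_sum_eq_zero (fun i : J => a i) (LinearMap.ker π)
    fun y hy hy0 => let ⟨i, hi, hpos⟩ := h y hy hy0; ⟨⟨i, hi⟩, hpos⟩
  obtain ⟨l, hl⟩ : ∃ l : F →ₗ[ℝ] ℝ, ∀ x, l (π x) = ∑ i : J, c i * a i x := by
    have h1 : (∑ i : J, c i • a i) ∈ LinearMap.range π.dualMap := by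
      rw [LinearMap.range_dualMap_eq_dualAnnihilator_ker, Submodule.mem_dualAnnihilator]
      intro y hy
      simpa using hsum y hy
    obtain ⟨l, hl⟩ := h1
    exact ⟨l, fun x => by simpa using LinearMap.congr_fun hl x⟩
  obtain ⟨x₀, hx₀, hJ₀⟩ := hne
  have hle : ∀ x ∈ polyhedron a b, l (π x) ≤ ∑ i : J, c i * b i := by
    intro x hx
    rw [hl]
    exact Finset.sum_le_sum fun i _ => mul_le_mul_of_nonneg_left (hx i) (hc i).le
  have heq : ∀ x ∈ polyhedron a b, l (π x) = ∑ i : J, c i * b i → x ∈ face a b J := by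
    intro x hx he
    rw [hl] at he
    have h1 := (Finset.sum_eq_sum_iff_of_le fun (i : J) _ =>
      mul_le_mul_of_nonneg_left (hx i) (hc i).le).1 he
    exact ⟨hx, fun i hi => mul_left_cancel₀ (hc ⟨i, hi⟩).ne' (h1 ⟨i, hi⟩ (Finset.mem_univ _))⟩
  have hface : ∀ x ∈ face a b J, l (π x) = ∑ i : J, c i * b i := by
    intro x hx
    rw [hl]
    exact Finset.sum_congr rfl fun i _ => by rw [show a i x = b i from hx.2 i.2]
  refine ⟨fun _ => ⟨LinearMap.toContinuousLinearMap l, ?_⟩, ⟨Set.mapsTo_image _ _, ?_,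
    Set.surjOn_image _ _⟩, ?_⟩
  · ext z
    constructor
    · rintro ⟨x, hx, rfl⟩
      refine ⟨⟨x, hx.1, rfl⟩, ?_⟩
      rintro _ ⟨y, hy, rfl⟩
      simpa [hface x hx] using hle y hy
    · rintro ⟨⟨x, hx, rfl⟩, hmax⟩
      refine ⟨x, heq x hx (le_antisymm (hle x hx) ?_), rfl⟩
      have := hmax (π x₀) ⟨x₀, hx₀, rfl⟩
      simpa [hface x₀ ⟨hx₀, hJ₀⟩] using this
  · intro x hx y hy hxy
    by_contra hne
    obtain ⟨i, hi, hpos⟩ := h (x - y) (by simp [hxy]) (sub_ne_zero.2 hne)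
    have h1 : a i x = b i := hx.2 hi
    have h2 : a i y = b i := hy.2 hi
    simp [h1, h2] at hpos
  · ext x
    constructor
    · rintro ⟨hx, y, hy, hxy⟩
      exact heq x hx (by rw [← hxy, hface y hy])
    · exact fun hx => ⟨hx.1, x, hx, rfl⟩

end Topology

/-! ### Stability of simple polytopes -/

/-- The active sets of a simple polytope do not change under small changes of the right-hand side.
Simplicity enters as `hsimple`: at each point the values of the tight functionals can be prescribed
by a linear map. -/
theorem eventually_activeSets_eq {ι E : Type*} [Finite ι] [NormedAddCommGroup E] [NormedSpace ℝ E]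
    [FiniteDimensional ℝ E] (a : ι → E →ₗ[ℝ] ℝ) (b : ι → ℝ) (hrec : ∀ y ≠ 0, ∃ i, 0 < a i y)
    (hsimple : ∀ y ∈ polyhedron a b, ∃ L : (ι → ℝ) →ₗ[ℝ] E, ∀ i ∈ active a b y, ∀ c,
      a i (L c) = c i) :
    ∀ᶠ c in 𝓝 b, activeSets a c = activeSets a b := by
  classical
  have := Fintype.ofFinite ι
  have hcont : ∀ i, Continuous (a i) := fun i => (a i).continuous_of_finiteDimensional
  -- subsets of active sets are active sets
  have hdown : ∀ y ∈ polyhedron a b, ∀ J ⊆ active a b y, J ∈ activeSets a b := by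
    intro y hy J hJ
    obtain ⟨L, hL⟩ := hsimple y hy
    set d := L fun i => if i ∈ J then 0 else -1 with hd
    have hslack := (eventually_lt_of_notMem_active hy d).filter_mono
      (nhdsWithin_le_nhds (s := Set.Ioi 0))
    obtain ⟨t, ht, htpos⟩ := (hslack.and self_mem_nhdsWithin).exists
    have htpos : 0 < t := htpos
    have hval : ∀ i ∈ active a b y, a i (y + t • d) = b i + t * (if i ∈ J then 0 else -1) := by
      intro i hi
      have : a i y = b i := hi
      simp [hd, hL i hi, this]
    refine ⟨y + t • d, fun i => ?_, ?_⟩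
    · by_cases hi : i ∈ active a b y
      · rw [hval i hi]
        split_ifs <;> linarith
      · exact (ht i hi).le
    · ext i
      by_cases hi : i ∈ active a b y
      · change a i (y + t • d) = b i ↔ i ∈ J
        rw [hval i hi]
        split_ifs with hiJ
        · simp [hiJ]
        · simp [hiJ, htpos.ne']
      · exact iff_of_false (ht i hi).ne fun h => hi (hJ h)
  obtain ⟨B, hB⟩ : ∃ B, ∀ i, b i + 1 ≤ B :=
    let ⟨B, hB⟩ := (Set.finite_range fun i => b i + 1).bddAbove
    ⟨B, fun i => hB ⟨i, rfl⟩⟩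
  obtain ⟨R, hR⟩ := exists_norm_le_of_mem_polyhedron a hrec B
  have hle : ∀ᶠ c in 𝓝 b, ∀ i, c i ≤ B := by
    rw [eventually_all]
    intro i
    have : b i < B := by linarith [hB i]
    exact ((continuous_apply i).continuousAt.eventually_lt continuousAt_const this).mono
      fun c hc => hc.le
  have hsub : ∀ᶠ c in 𝓝 b, ∀ y ∈ Metric.closedBall (0 : E) R,
      y ∈ polyhedron a c → active a c y ∈ activeSets a b := by
    refine (isCompact_closedBall (0 : E) R).eventually_forall_of_forall_eventually
      (P := fun c y => y ∈ polyhedron a c → active a c y ∈ activeSets a b) fun y _ => ?_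
    have hfst : ∀ i, Continuous fun z : (ι → ℝ) × E => z.1 i := fun i =>
      (continuous_apply i).comp continuous_fst
    have hsnd : ∀ i, Continuous fun z : (ι → ℝ) × E => a i z.2 := fun i =>
      (hcont i).comp continuous_snd
    by_cases hy : y ∈ polyhedron a b
    · have h1 : ∀ᶠ z : (ι → ℝ) × E in 𝓝 (b, y), ∀ i, i ∉ active a b y → a i z.2 < z.1 i := by
        rw [eventually_all]
        intro i
        by_cases hi : i ∈ active a b y
        · exact Eventually.of_forall fun z h => absurd hi h
        · exact ((hsnd i).continuousAt.eventually_lt (hfst i).continuousAt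
            (lt_of_notMem_active hy hi)).mono fun z hz _ => hz
      filter_upwards [h1] with z hz _
      refine hdown y hy _ fun i hi => ?_
      by_contra hcon
      exact (hz i hcon).ne hi
    · obtain ⟨i, hi⟩ : ∃ i, b i < a i y := by
        simpa [polyhedron] using hy
      filter_upwards [(hfst i).continuousAt.eventually_lt (hsnd i).continuousAt hi] with z hz hmem
      exact absurd (hmem i) (not_le.2 hz)
  have hsup : ∀ᶠ c in 𝓝 b, ∀ J : Set ι, J ∈ activeSets a b → J ∈ activeSets a c := by
    rw [eventually_all]
    intro J
    by_cases hJ : J ∈ activeSets a b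
    swap
    · exact Eventually.of_forall fun c h => absurd h hJ
    obtain ⟨y, hy, rfl⟩ := hJ
    obtain ⟨L, hL⟩ := hsimple y hy
    have hLc : Continuous L := L.continuous_of_finiteDimensional
    have h1 : ∀ᶠ c in 𝓝 b, ∀ i, i ∉ active a b y → a i (y + L (c - b)) < c i := by
      rw [eventually_all]
      intro i
      by_cases hi : i ∈ active a b y
      · exact Eventually.of_forall fun z h => absurd hi h
      · have hc : Continuous fun c => a i (y + L (c - b)) :=
          (hcont i).comp (continuous_const.add (hLc.comp (continuous_id.sub continuous_const)))
        refine (hc.continuousAt.eventually_lt (continuous_apply i).continuousAt ?_).mono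
          fun z hz _ => hz
        simpa using lt_of_notMem_active hy hi
    filter_upwards [h1] with c hc _
    have hval : ∀ i ∈ active a b y, a i (y + L (c - b)) = c i := by
      intro i hi
      have : a i y = b i := hi
      rw [map_add, hL i hi, this]
      simp
    refine ⟨y + L (c - b), fun i => ?_, ?_⟩
    · by_cases hi : i ∈ active a b y
      · exact (hval i hi).le
      · exact (hc i hi).le
    · ext i
      by_cases hi : i ∈ active a b y
      · exact iff_of_true (hval i hi) hi
      · exact iff_of_false (hc i hi).ne hi
  filter_upwards [hle, hsub, hsup] with c h1 h2 h3
  refine Set.Subset.antisymm ?_ fun J hJ => h3 J hJ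
  rintro _ ⟨y, hy, rfl⟩
  exact h2 y (by simpa using hR c h1 y hy) hy

/-! ### The polygon -/

/-- Row `i` of an `n × 2` matrix as a linear functional. -/
def rowFun {n : ℕ} (A : Matrix (Fin n) (Fin 2) ℝ) (i : Fin n) : (Fin 2 → ℝ) →ₗ[ℝ] ℝ :=
  LinearMap.proj i ∘ₗ A.mulVecLin

theorem rowFun_apply {n : ℕ} (A : Matrix (Fin n) (Fin 2) ℝ) (i : Fin n) (y : Fin 2 → ℝ) :
    rowFun A i y = A i 0 * y 0 + A i 1 * y 1 := by
  simp [rowFun, Matrix.mulVec, dotProduct, Fin.sum_univ_two]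

/-- The linear functional `y ↦ (V^ε y)_i`. -/
noncomputable def rowV (n : ℕ) (ε : ℝ) (i : Fin n) : (Fin 2 → ℝ) →ₗ[ℝ] ℝ :=
  rowFun (blockV n ε) i

theorem polygon_eq_polyhedron (n : ℕ) (ε : ℝ) :
    polygon n ε = polyhedron (rowV n ε) (rhs n ε) := rfl

/-- The parameter `s_i` of the `i`-th row of `V^ε`; it has no meaning for the last row. -/
noncomputable def param (n i : ℕ) : ℝ := (n : ℝ) - 2 - 2 * i

/-- The slack of `y` in the `i`-th inequality of the polygon, divided by the `i`-th right-hand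
side. -/
noncomputable def slack (n : ℕ) (ε : ℝ) (y : Fin 2 → ℝ) (i : ℕ) : ℝ :=
  if i + 1 = n then 1 + y 0
  else 1 - (1 - ε * param n i ^ 2) * y 0 - ε * param n i * y 1

theorem rowV_apply (n : ℕ) (ε : ℝ) (i : Fin n) (y : Fin 2 → ℝ) :
    rowV n ε i y = blockV n ε i 0 * y 0 + blockV n ε i 1 * y 1 :=
  rowFun_apply _ i y

theorem rhs_sub_rowV {n : ℕ} (hn : Even n) (ε : ℝ) (i : Fin n) (y : Fin 2 → ℝ) :
    rhs n ε i - rowV n ε i y = rhs n ε i * slack n ε y i := by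
  rw [rowV_apply]
  unfold rhs slack blockV param
  by_cases h1 : (i : ℕ) + 1 = n
  · have h2 : ¬ Even (i : ℕ) := by
      rw [← h1] at hn; exact Nat.even_add_one.1 hn
    simp [h1, h2]; ring
  · by_cases h2 : Even (i : ℕ)
    · simp [h1, h2]; ring
    · simp [h1, h2]; ring

theorem rhs_pos (n : ℕ) {ε : ℝ} (hε : 0 < ε) (i : Fin n) : 0 < rhs n ε i := by
  unfold rhs; split_ifs <;> linarith

theorem mem_polygon_iff {n : ℕ} (hn : Even n) {ε : ℝ} (hε : 0 < ε) {y : Fin 2 → ℝ} :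
    y ∈ polyhedron (rowV n ε) (rhs n ε) ↔ ∀ i < n, 0 ≤ slack n ε y i := by
  constructor
  · intro h i hi
    have h1 := h ⟨i, hi⟩
    rw [← sub_nonneg, rhs_sub_rowV hn] at h1
    exact nonneg_of_mul_nonneg_right h1 (rhs_pos n hε _)
  · intro h i
    rw [← sub_nonneg, rhs_sub_rowV hn]
    exact mul_nonneg (rhs_pos n hε _).le (h i i.2)

theorem mem_active_iff {n : ℕ} (hn : Even n) {ε : ℝ} (hε : 0 < ε) {y : Fin 2 → ℝ} {i : Fin n} :
    i ∈ active (rowV n ε) (rhs n ε) y ↔ slack n ε y i = 0 := by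
  change rowV n ε i y = rhs n ε i ↔ _
  rw [eq_comm, ← sub_eq_zero, rhs_sub_rowV hn, mul_eq_zero, or_iff_right (rhs_pos n hε _).ne']

theorem one_add_mul_pos {n : ℕ} {ε : ℝ} (hε : 0 < ε) (hsmall : ε * n ^ 2 < 1) {i j : ℕ}
    (hi : i + 1 < n) (hj : j + 1 < n) : 0 < 1 + ε * (param n i * param n j) := by
  have hi' : (i : ℝ) + 1 + 1 ≤ n := by exact_mod_cast hi
  have hj' : (j : ℝ) + 1 + 1 ≤ n := by exact_mod_cast hj
  have hi0 : (0 : ℝ) ≤ i := by positivity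
  have hj0 : (0 : ℝ) ≤ j := by positivity
  have h1 : |param n i| ≤ n := abs_le.2 ⟨by unfold param; linarith, by unfold param; linarith⟩
  have h2 : |param n j| ≤ n := abs_le.2 ⟨by unfold param; linarith, by unfold param; linarith⟩
  have h3 : |param n i * param n j| ≤ (n : ℝ) ^ 2 := by
    rw [abs_mul, sq]
    exact mul_le_mul h1 h2 (abs_nonneg _) (by positivity)
  have h4 := (abs_le.1 h3).1
  nlinarith

theorem param_lt {n i j : ℕ} (h : i < j) : param n j < param n i := by
  have : (i : ℝ) < j := by exact_mod_cast h
  unfold param; linarith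

/-- Two inequalities of the polygon that are tight at a common point of it are cyclically
adjacent: as a function of the parameter the slack is a quadratic polynomial, so it is determined
by its two zeros, and it would be negative at a parameter separated from them. -/
theorem adjacent_of_active {n : ℕ} (hn : 4 ≤ n) {ε : ℝ} (hε : 0 < ε) (hsmall : ε * n ^ 2 < 1)
    {y : Fin 2 → ℝ} (hy : ∀ i < n, 0 ≤ slack n ε y i) {i j : ℕ} (hij : i < j) (hj : j < n)
    (hi0 : slack n ε y i = 0) (hj0 : slack n ε y j = 0) :
    j = i + 1 ∨ (i = 0 ∧ j + 1 = n) := by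
  by_contra! hcon
  have hi1 : i + 1 ≠ n := by omega
  rw [slack, if_neg hi1] at hi0
  by_cases hjn : j + 1 = n
  · rw [slack, if_pos hjn] at hj0
    have hy0 : y 0 = -1 := by linarith
    have hi2 : 0 < i := by
      rcases Nat.eq_zero_or_pos i with h | h
      · exact absurd hjn (hcon.2 h)
      · exact h
    have hi3 : i + 2 < n := by omega
    have e1 := hy 0 (by omega)
    have e2 := hy (n - 2) (by omega)
    rw [slack, if_neg (by omega)] at e1 e2
    have p1 : param n 0 = n - 2 := by simp [param]
    have p2 : param n (n - 2) = -(n - 2) := by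
      simp [param, Nat.cast_sub (show 2 ≤ n by omega)]; ring
    rw [p1, hy0] at e1
    rw [p2, hy0] at e2
    rw [hy0] at hi0
    have l1 : param n i < n - 2 := p1 ▸ param_lt hi2
    have l2 : -((n : ℝ) - 2) < param n i := p2 ▸ param_lt (show i < n - 2 by omega)
    have hm : (0 : ℝ) < n - 2 := by
      have : (4 : ℝ) ≤ n := by exact_mod_cast hn
      linarith
    generalize param n i = s at *
    generalize (n : ℝ) - 2 = m at *
    have q0 : ε * s * y 1 = 2 - ε * s ^ 2 := by linarith
    rcases lt_trichotomy s 0 with hs | hs | hs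
    · have h2 : ε * m * (s * y 1) = m * (2 - ε * s ^ 2) := by rw [← q0]; ring
      have h3 : 0 ≤ (-s) * (2 - ε * m ^ 2 + ε * m * y 1) :=
        mul_nonneg (by linarith) (by linarith)
      have h4 : 0 < (m + s) * (2 + ε * m * (-s)) :=
        mul_pos (by linarith) (by nlinarith [mul_pos (mul_pos hε hm) (neg_pos.2 hs)])
      nlinarith
    · subst hs; norm_num at q0
    · have h2 : ε * m * (s * y 1) = m * (2 - ε * s ^ 2) := by rw [← q0]; ring
      have h3 : 0 ≤ s * (2 - ε * m ^ 2 - ε * m * y 1) :=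
        mul_nonneg (by linarith) (by linarith)
      have h4 : 0 < (m - s) * (2 + ε * m * s) :=
        mul_pos (by linarith) (by nlinarith [mul_pos (mul_pos hε hm) hs])
      nlinarith
  · have hjn' : j + 1 < n := by omega
    rw [slack, if_neg hjn] at hj0
    have e1 := hy (i + 1) (by omega)
    rw [slack, if_neg (by omega)] at e1
    have l1 := param_lt (n := n) (show i < i + 1 by omega)
    have l2 := param_lt (n := n) (show i + 1 < j by omega)
    have hpos := one_add_mul_pos hε hsmall (show i + 1 < n by omega) hjn'
    generalize param n i = s at *
    generalize param n j = u at *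
    generalize param n (i + 1) = t at *
    have h1 : y 1 = (s + u) * y 0 := by
      have : ε * (s - u) * (y 1 - (s + u) * y 0) = 0 := by linear_combination hj0 - hi0
      rcases mul_eq_zero.1 this with h | h
      · exfalso
        have := mul_pos hε (show 0 < s - u by linarith)
        linarith
      · linarith
    have h2 : y 0 * (1 + ε * (s * u)) = 1 := by rw [h1] at hi0; linear_combination -hi0
    have h3 : 0 < y 0 := pos_of_mul_pos_left (by rw [h2]; exact one_pos) hpos.le
    have h4 : 0 ≤ ε * y 0 * ((t - s) * (t - u)) := by
      rw [h1] at e1 hi0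
      calc (0 : ℝ) ≤ _ := e1
        _ = _ := by linear_combination hi0
    have h5 : (t - s) * (t - u) < 0 := mul_neg_of_neg_of_pos (by linarith) (by linarith)
    have h6 := mul_pos hε h3
    nlinarith

/-- The determinant of rows `i` and `j` of `V^ε`. -/
noncomputable def detV (n : ℕ) (ε : ℝ) (i j : Fin n) : ℝ :=
  blockV n ε i 0 * blockV n ε j 1 - blockV n ε i 1 * blockV n ε j 0

theorem detV_swap (n : ℕ) (ε : ℝ) (i j : Fin n) : detV n ε i j = -detV n ε j i := by
  unfold detV; ring

theorem detV_ne_zero {n : ℕ} (hn : 4 ≤ n) {ε : ℝ} (hε : 0 < ε) (hsmall : ε * n ^ 2 < 1)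
    {i j : Fin n} (h : (j : ℕ) = i + 1 ∨ ((i : ℕ) = 0 ∧ (j : ℕ) + 1 = n)) : detV n ε i j ≠ 0 := by
  have hn' : (4 : ℝ) ≤ n := by exact_mod_cast hn
  have hi1 : (i : ℕ) + 1 ≠ n := by have := j.2; omega
  by_cases hj1 : (j : ℕ) + 1 = n
  · -- then `i` is one of the two neighbours of the last row, with parameter `±(n - 2) ≠ 0`
    have hp : param n i ≠ 0 := by
      unfold param
      rcases h with h | h
      · have : (i : ℝ) + 1 + 1 = n := by exact_mod_cast (by omega : (i : ℕ) + 1 + 1 = n)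
        intro h0; linarith
      · rw [h.1]; intro h0; push_cast at h0; linarith
    have hp' : (n : ℝ) - 2 - 2 * (i : ℕ) ≠ 0 := hp
    unfold detV blockV
    by_cases h2 : Even (i : ℕ) <;> simp [hi1, hj1, h2, hε.ne', hp']
  · have h' : (j : ℕ) = i + 1 := by omega
    have hpos := one_add_mul_pos hε hsmall (show (i : ℕ) + 1 < n by omega)
      (show (j : ℕ) + 1 < n by omega)
    have hlt := param_lt (n := n) (show (i : ℕ) < j by omega)
    have key : ε * ε * ((param n j - param n i) * (1 + ε * (param n i * param n j))) ≠ 0 := by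
      have : param n j - param n i ≠ 0 := by intro h0; linarith
      exact mul_ne_zero (mul_ne_zero hε.ne' hε.ne') (mul_ne_zero this hpos.ne')
    have hev : Even (j : ℕ) ↔ ¬ Even (i : ℕ) := by rw [h']; exact Nat.even_add_one
    intro h0
    apply key
    unfold detV blockV at h0
    by_cases h2 : Even (i : ℕ)
    · simp only [hi1, hj1, h2, hev, if_true, if_false, not_true_eq_false, Matrix.cons_val_zero,
        Matrix.cons_val_one] at h0
      unfold param
      linear_combination h0
    · simp only [hi1, hj1, h2, hev, if_true, if_false, not_false_eq_true, Matrix.cons_val_zero,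
        Matrix.cons_val_one] at h0
      unfold param
      linear_combination h0

/-- At each point of the polygon the tight inequalities are among two with linearly independent
normals, one with an even and one with an odd index. -/
theorem exists_active_subset_pair {n : ℕ} (hn : 4 ≤ n) (heven : Even n) {ε : ℝ} (hε : 0 < ε)
    (hsmall : ε * n ^ 2 < 1) {y : Fin 2 → ℝ} (hy : y ∈ polyhedron (rowV n ε) (rhs n ε)) :
    ∃ i j : Fin n, Even (i : ℕ) ∧ Odd (j : ℕ) ∧ detV n ε i j ≠ 0 ∧
      active (rowV n ε) (rhs n ε) y ⊆ {i, j} := by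
  have hy' := (mem_polygon_iff heven hε).1 hy
  have hadj : ∀ i ∈ active (rowV n ε) (rhs n ε) y, ∀ j ∈ active (rowV n ε) (rhs n ε) y,
      (i : ℕ) < j → (j : ℕ) = i + 1 ∨ ((i : ℕ) = 0 ∧ (j : ℕ) + 1 = n) := fun i hi j hj hij =>
    adjacent_of_active hn hε hsmall hy' hij j.2 ((mem_active_iff heven hε).1 hi)
      ((mem_active_iff heven hε).1 hj)
  -- it suffices to find two adjacent indices in increasing order
  suffices h : ∃ i j : Fin n, ((j : ℕ) = i + 1 ∨ ((i : ℕ) = 0 ∧ (j : ℕ) + 1 = n)) ∧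
      active (rowV n ε) (rhs n ε) y ⊆ {i, j} by
    obtain ⟨i, j, hij, hsub⟩ := h
    have hd := detV_ne_zero hn hε hsmall hij
    rcases Nat.even_or_odd (i : ℕ) with hi | hi
    · refine ⟨i, j, hi, ?_, hd, hsub⟩
      rcases hij with h | ⟨-, h⟩
      · rw [h]; exact hi.add_one
      · rw [← Nat.not_even_iff_odd]; rw [← h] at heven; exact Nat.even_add_one.1 heven
    · refine ⟨j, i, ?_, hi, ?_, by rwa [Set.pair_comm]⟩
      · rcases hij with h | ⟨h, -⟩
        · rw [h]; exact hi.add_one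
        · rw [h] at hi; exact absurd hi (by decide)
      · rw [detV_swap]; exact neg_ne_zero.2 hd
  by_cases h2 : ∃ i ∈ active (rowV n ε) (rhs n ε) y, ∃ j ∈ active (rowV n ε) (rhs n ε) y,
      (i : ℕ) < j
  · obtain ⟨i, hi, j, hj, hij⟩ := h2
    refine ⟨i, j, hadj i hi j hj hij, fun k hk => ?_⟩
    by_contra hcon
    simp only [Set.mem_insert_iff, Set.mem_singleton_iff, not_or, Fin.ext_iff] at hcon
    have h1 := hadj i hi j hj hij
    have h3 := hadj i hi k hk
    have h4 := hadj k hk i hi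
    have h5 := hadj j hj k hk
    have h6 := hadj k hk j hj
    omega
  · push Not at h2
    by_cases h1 : (active (rowV n ε) (rhs n ε) y).Nonempty
    · obtain ⟨i, hi⟩ := h1
      have hall : ∀ k ∈ active (rowV n ε) (rhs n ε) y, k = i := fun k hk =>
        Fin.ext (le_antisymm (h2 i hi k hk) (h2 k hk i hi))
      by_cases hin : (i : ℕ) + 1 < n
      · exact ⟨i, ⟨i + 1, hin⟩, Or.inl rfl, fun k hk => by simp [hall k hk]⟩
      · exact ⟨⟨0, by omega⟩, i, Or.inr ⟨rfl, by have := i.2; omega⟩,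
          fun k hk => by simp [hall k hk]⟩
    · rw [Set.not_nonempty_iff_eq_empty] at h1
      exact ⟨⟨0, by omega⟩, ⟨1, by omega⟩, Or.inl rfl, by simp [h1]⟩

/-- Two equations of the polygon with independent normals have at most one common solution. -/
theorem eq_zero_of_rowV_eq_zero {n : ℕ} {ε : ℝ} {i j : Fin n} (hd : detV n ε i j ≠ 0)
    {y : Fin 2 → ℝ} (hi : rowV n ε i y = 0) (hj : rowV n ε j y = 0) : y = 0 := by
  rw [rowV_apply] at hi hj
  have h0 : detV n ε i j * y 0 = 0 := by
    unfold detV; linear_combination blockV n ε j 1 * hi - blockV n ε i 1 * hj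
  have h1 : detV n ε i j * y 1 = 0 := by
    unfold detV; linear_combination blockV n ε i 0 * hj - blockV n ε j 0 * hi
  ext t
  fin_cases t
  · exact (mul_eq_zero.1 h0).resolve_left hd
  · exact (mul_eq_zero.1 h1).resolve_left hd

/-- Simplicity of the polygon, by Cramer's rule: two independent rows can take any values. -/
theorem exists_linearMap_rowV {n : ℕ} {ε : ℝ} {i j : Fin n} (hd : detV n ε i j ≠ 0) :
    ∃ L : (Fin n → ℝ) →ₗ[ℝ] (Fin 2 → ℝ), ∀ k ∈ ({i, j} : Set (Fin n)), ∀ c,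
      rowV n ε k (L c) = c k := by
  refine ⟨LinearMap.pi ![
    (detV n ε i j)⁻¹ • (blockV n ε j 1 • LinearMap.proj i - blockV n ε i 1 • LinearMap.proj j),
    (detV n ε i j)⁻¹ • (blockV n ε i 0 • LinearMap.proj j - blockV n ε j 0 • LinearMap.proj i)],
    ?_⟩
  intro k hk c
  rw [rowV_apply]
  simp only [LinearMap.pi_apply, Matrix.cons_val_zero, Matrix.cons_val_one, LinearMap.smul_apply,
    LinearMap.sub_apply, LinearMap.proj_apply, smul_eq_mul]
  rcases hk with rfl | rfl
  · field_simp
    unfold detV; ring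
  · field_simp
    unfold detV; ring

theorem exists_rowV_pos {n : ℕ} (hn : 4 ≤ n) (heven : Even n) {ε : ℝ} (hε : 0 < ε)
    {y : Fin 2 → ℝ} (hy : y ≠ 0) : ∃ i, 0 < rowV n ε i y := by
  by_contra! hcon
  -- the `i`-th row is `1 - slack`, up to the positive factor `rhs n ε i`
  have hlin : ∀ i : Fin n, 1 ≤ slack n ε y i := by
    intro i
    have h1 := rhs_sub_rowV heven ε i y
    have h2 := rhs_pos n hε i
    have h3 := hcon i
    have h4 : rhs n ε i * 1 ≤ rhs n ε i * slack n ε y i := by linarith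
    exact le_of_mul_le_mul_left h4 h2
  obtain ⟨m, hm⟩ := heven
  have hn' : (4 : ℝ) ≤ n := by exact_mod_cast hn
  have a1 := hlin ⟨n - 1, by omega⟩
  have a2 := hlin ⟨m - 1, by omega⟩
  have a3 := hlin ⟨0, by omega⟩
  have a4 := hlin ⟨n - 2, by omega⟩
  have p1 : param n 0 = n - 2 := by simp [param]
  have p2 : param n (n - 2) = -(n - 2) := by
    simp [param, Nat.cast_sub (show 2 ≤ n by omega)]; ring
  have p3 : param n (m - 1) = 0 := by
    simp [param, Nat.cast_sub (show 1 ≤ m by omega), hm]; ring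
  rw [slack, if_pos (by simp only; omega)] at a1
  rw [slack, if_neg (by simp only; omega)] at a2 a3 a4
  simp only [p1, p2, p3] at a2 a3 a4
  have h0 : y 0 = 0 := by linarith
  rw [h0] at a3 a4
  have h1 : y 1 = 0 := by
    have h2 : 0 < ε * (n - 2) := mul_pos hε (by linarith)
    have h3 : ε * (n - 2) * y 1 = 0 := by linarith
    exact (mul_eq_zero.1 h3).resolve_left h2.ne'
  apply hy
  ext t
  fin_cases t
  · exact h0
  · exact h1

theorem eventually_polygon_activeSets_eq {n : ℕ} (hn : 4 ≤ n) (heven : Even n) {ε : ℝ}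
    (hε : 0 < ε) (hsmall : ε * n ^ 2 < 1) :
    ∀ᶠ c in 𝓝 (rhs n ε), activeSets (rowV n ε) c = activeSets (rowV n ε) (rhs n ε) := by
  refine eventually_activeSets_eq _ _ (fun y hy => exists_rowV_pos hn heven hε hy) fun y hy => ?_
  obtain ⟨i, j, -, -, hd, hsub⟩ := exists_active_subset_pair hn heven hε hsmall hy
  obtain ⟨L, hL⟩ := exists_linearMap_rowV hd
  exact ⟨L, fun k hk => hL k (hsub hk)⟩

/-- If two inequalities of the polygon are tight at `y`, then they are the only ones, and one index
is even and the other odd. -/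
theorem exists_active_eq_pair {n : ℕ} (hn : 4 ≤ n) (heven : Even n) {ε : ℝ} (hε : 0 < ε)
    (hsmall : ε * n ^ 2 < 1) {y : Fin 2 → ℝ} (hy : y ∈ polyhedron (rowV n ε) (rhs n ε))
    (h : ¬ (active (rowV n ε) (rhs n ε) y).Subsingleton) :
    ∃ i j : Fin n, Even (i : ℕ) ∧ Odd (j : ℕ) ∧ detV n ε i j ≠ 0 ∧
      active (rowV n ε) (rhs n ε) y = {i, j} := by
  obtain ⟨i, j, hi, hj, hd, hsub⟩ := exists_active_subset_pair hn heven hε hsmall hy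
  refine ⟨i, j, hi, hj, hd, Set.Subset.antisymm hsub ?_⟩
  rw [Set.not_subsingleton_iff] at h
  obtain ⟨k, hk, l, hl, hkl⟩ := h
  have h1 := hsub hk
  have h2 := hsub hl
  simp only [Set.mem_insert_iff, Set.mem_singleton_iff] at h1 h2
  rintro x (rfl | rfl) <;> grind

theorem not_subsingleton_active_of_mem_extremePoints {n : ℕ} {ε : ℝ} {y : Fin 2 → ℝ}
    (hy : y ∈ (polyhedron (rowV n ε) (rhs n ε)).extremePoints ℝ) :
    ¬ (active (rowV n ε) (rhs n ε) y).Subsingleton := by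
  intro hs
  rcases hs.eq_empty_or_singleton with h | ⟨i, h⟩
  · have := eq_zero_of_mem_extremePoints hy (d := ![1, 0]) (by simp [h])
    simpa using congrFun this 0
  · have := eq_zero_of_mem_extremePoints hy (d := ![-blockV n ε i 1, blockV n ε i 0]) (by
      simp [h, rowV_apply]; ring)
    have h1 : blockV n ε i 1 = 0 := by simpa using congrFun this 0
    have h2 : blockV n ε i 0 = 0 := by simpa using congrFun this 1
    have := eq_zero_of_mem_extremePoints hy (d := ![1, 0]) (by simp [h, rowV_apply, h2])
    simpa using congrFun this 0

/-- Each pair of cyclically adjacent inequalities is tight at some point of the polygon. -/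
theorem exists_vertex {n : ℕ} (hn : 4 ≤ n) {ε : ℝ} (hε : 0 < ε)
    (hsmall : ε * n ^ 2 < 1) (i : ℕ) (hi : i < n) :
    ∃ y : Fin 2 → ℝ, (∀ k < n, 0 ≤ slack n ε y k) ∧ slack n ε y i = 0 ∧
      slack n ε y ((i + 1) % n) = 0 := by
  have hn' : (4 : ℝ) ≤ n := by exact_mod_cast hn
  have p1 : param n 0 = n - 2 := by simp [param]
  have p2 : param n (n - 2) = -(n - 2) := by
    simp [param, Nat.cast_sub (show 2 ≤ n by omega)]; ring
  have hm : (0 : ℝ) < n - 2 := by linarith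
  have hεm : ε * ((n : ℝ) - 2) ^ 2 < 1 := by nlinarith
  have hbound : ∀ k, k + 1 < n → -((n : ℝ) - 2) ≤ param n k ∧ param n k ≤ n - 2 := by
    intro k hk
    have : (k : ℝ) + 1 + 1 ≤ n := by exact_mod_cast hk
    have : (0 : ℝ) ≤ k := by positivity
    unfold param
    constructor <;> linarith
  rcases (by omega : i + 2 < n ∨ i + 2 = n ∨ i + 1 = n) with h | h | h
  · have hmod : (i + 1) % n = i + 1 := Nat.mod_eq_of_lt (by omega)
    have hpos := one_add_mul_pos hε hsmall (show i + 1 < n by omega) (show i + 1 + 1 < n by omega)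
    have hne := hpos.ne'
    have hsl : ∀ k, k + 1 ≠ n → slack n ε ![1 / (1 + ε * (param n i * param n (i + 1))),
        (param n i + param n (i + 1)) / (1 + ε * (param n i * param n (i + 1)))] k =
        ε * ((param n k - param n i) * (param n k - param n (i + 1))) /
          (1 + ε * (param n i * param n (i + 1))) := by
      intro k hk
      rw [slack, if_neg hk]
      simp only [Matrix.cons_val_zero, Matrix.cons_val_one]
      generalize hD : 1 + ε * (param n i * param n (i + 1)) = D at hne ⊢
      field_simp
      rw [← hD]
      ring
    refine ⟨![1 / (1 + ε * (param n i * param n (i + 1))),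
        (param n i + param n (i + 1)) / (1 + ε * (param n i * param n (i + 1)))],
      fun k hk => ?_, ?_, ?_⟩
    rotate_left
    · rw [hsl i (by omega)]; simp
    · rw [hmod, hsl (i + 1) (by omega)]; simp
    by_cases hkn : k + 1 = n
    · rw [slack, if_pos hkn]
      simp only [Matrix.cons_val_zero]
      positivity
    · rw [hsl k hkn]
      -- no parameter lies strictly between two consecutive ones
      refine div_nonneg (mul_nonneg hε.le ?_) hpos.le
      rcases Nat.lt_or_ge k (i + 1) with hki | hki
      · have : (k : ℝ) ≤ i := by exact_mod_cast (by omega : k ≤ i)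
        refine mul_nonneg ?_ ?_ <;> (unfold param; push_cast; linarith)
      · have : (i : ℝ) + 1 ≤ k := by exact_mod_cast hki
        refine mul_nonneg_of_nonpos_of_nonpos ?_ ?_ <;> (unfold param; push_cast; linarith)
  · have hmod : (i + 1) % n = i + 1 := Nat.mod_eq_of_lt (by omega)
    have hi' : i = n - 2 := by omega
    have hsl : ∀ k, k + 1 ≠ n → slack n ε
        ![-1, -((2 - ε * ((n : ℝ) - 2) ^ 2) / (ε * (n - 2)))] k =
        (param n k + (n - 2)) * (2 - ε * (n - 2) * param n k) / (n - 2) := by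
      intro k hk
      rw [slack, if_neg hk]
      simp only [Matrix.cons_val_zero, Matrix.cons_val_one]
      field_simp
      ring
    refine ⟨![-1, -((2 - ε * ((n : ℝ) - 2) ^ 2) / (ε * (n - 2)))], fun k hk => ?_, ?_, ?_⟩
    rotate_left
    · rw [hsl i (by omega), hi', p2]; simp
    · rw [hmod, slack, if_pos (by omega)]; simp
    by_cases hkn : k + 1 = n
    · rw [slack, if_pos hkn]; simp
    · rw [hsl k hkn]
      obtain ⟨b1, b2⟩ := hbound k (by omega)
      refine div_nonneg (mul_nonneg (by linarith) ?_) hm.le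
      have := mul_le_mul_of_nonneg_left b2 (mul_pos hε hm).le
      nlinarith
  · have hmod : (i + 1) % n = 0 := by rw [h]; exact Nat.mod_self n
    have hsl : ∀ k, k + 1 ≠ n → slack n ε
        ![-1, (2 - ε * ((n : ℝ) - 2) ^ 2) / (ε * (n - 2))] k =
        ((n - 2) - param n k) * (2 + ε * (n - 2) * param n k) / (n - 2) := by
      intro k hk
      rw [slack, if_neg hk]
      simp only [Matrix.cons_val_zero, Matrix.cons_val_one]
      field_simp
      ring
    refine ⟨![-1, (2 - ε * ((n : ℝ) - 2) ^ 2) / (ε * (n - 2))], fun k hk => ?_, ?_, ?_⟩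
    rotate_left
    · rw [slack, if_pos h]; simp
    · rw [hmod, hsl 0 (by omega), p1]; simp
    by_cases hkn : k + 1 = n
    · rw [slack, if_pos hkn]; simp
    · rw [hsl k hkn]
      obtain ⟨b1, b2⟩ := hbound k (by omega)
      refine div_nonneg (mul_nonneg (by linarith) ?_) hm.le
      have := mul_le_mul_of_nonneg_left b1 (mul_pos hε hm).le
      nlinarith

theorem isBounded_polyhedron_rowV {n : ℕ} (hn : 4 ≤ n) (heven : Even n) {ε : ℝ} (hε : 0 < ε)
    (c : Fin n → ℝ) : Bornology.IsBounded (polyhedron (rowV n ε) c) := by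
  obtain ⟨B, hB⟩ := (Set.finite_range c).bddAbove
  obtain ⟨R, hR⟩ := exists_norm_le_of_mem_polyhedron (rowV n ε)
    (fun y hy => exists_rowV_pos hn heven hε hy) B
  exact isBounded_iff_forall_norm_le.2 ⟨R, hR c fun i => hB ⟨i, rfl⟩⟩

theorem isNGon_polygon {n : ℕ} (hn : 4 ≤ n) (heven : Even n) {ε : ℝ} (hε : 0 < ε)
    (hsmall : ε * n ^ 2 < 1) : IsNGon n (polygon n ε) := by
  rw [polygon_eq_polyhedron]
  choose v hv hv1 hv2 using fun i : Fin n => exists_vertex hn hε hsmall i i.2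
  -- cyclic successor
  let σ : Fin n → Fin n := fun i => ⟨(i + 1) % n, Nat.mod_lt _ (by omega)⟩
  have hmem : ∀ i, v i ∈ polyhedron (rowV n ε) (rhs n ε) := fun i =>
    (mem_polygon_iff heven hε).2 (hv i)
  have hact1 : ∀ i, i ∈ active (rowV n ε) (rhs n ε) (v i) := fun i =>
    (mem_active_iff heven hε).2 (hv1 i)
  have hact2 : ∀ i, σ i ∈ active (rowV n ε) (rhs n ε) (v i) := fun i =>
    (mem_active_iff heven hε).2 (hv2 i)
  have hσ : ∀ i : Fin n, ((i : ℕ) + 1 < n ∧ (σ i : ℕ) = i + 1) ∨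
      ((i : ℕ) + 1 = n ∧ (σ i : ℕ) = 0) := by
    intro i
    rcases Nat.lt_or_ge ((i : ℕ) + 1) n with h | h
    · exact Or.inl ⟨h, Nat.mod_eq_of_lt h⟩
    · have h' : (i : ℕ) + 1 = n := by omega
      exact Or.inr ⟨h', by simp [σ, h']⟩
  have hdet : ∀ i, detV n ε i (σ i) ≠ 0 := by
    intro i
    rcases hσ i with ⟨-, h⟩ | ⟨h, h'⟩
    · exact detV_ne_zero hn hε hsmall (Or.inl h)
    · rw [detV_swap]
      exact neg_ne_zero.2 (detV_ne_zero hn hε hsmall (Or.inr ⟨h', h⟩))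
  have hext : ∀ i, v i ∈ (polyhedron (rowV n ε) (rhs n ε)).extremePoints ℝ := fun i =>
    mem_extremePoints_of_active (hmem i) fun d hd =>
      eq_zero_of_rowV_eq_zero (hdet i) (hd _ (hact1 i)) (hd _ (hact2 i))
  have hinj : Function.Injective v := by
    intro i j hij
    have hadj : ∀ k ∈ active (rowV n ε) (rhs n ε) (v i), ∀ l ∈ active (rowV n ε) (rhs n ε) (v i),
        (k : ℕ) < l → (l : ℕ) = k + 1 ∨ ((k : ℕ) = 0 ∧ (l : ℕ) + 1 = n) := fun k hk l hl hkl =>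
      adjacent_of_active hn hε hsmall (hv i) hkl l.2 ((mem_active_iff heven hε).1 hk)
        ((mem_active_iff heven hε).1 hl)
    have m1 := hact1 i
    have m2 := hact2 i
    have m3 := hact1 j
    have m4 := hact2 j
    rw [← hij] at m3 m4
    have q1 := hadj _ m1 _ m3
    have q2 := hadj _ m3 _ m1
    have q3 := hadj _ m1 _ m4
    have q4 := hadj _ m4 _ m1
    have q5 := hadj _ m2 _ m3
    have q6 := hadj _ m3 _ m2
    have q7 := hadj _ m2 _ m4
    have q8 := hadj _ m4 _ m2
    have s1 := hσ i
    have s2 := hσ j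
    apply Fin.ext
    omega
  have hsurj : Set.range v = (polyhedron (rowV n ε) (rhs n ε)).extremePoints ℝ := by
    refine Set.Subset.antisymm (Set.range_subset_iff.2 hext) fun y hy => ?_
    have hns := not_subsingleton_active_of_mem_extremePoints hy
    rw [Set.not_subsingleton_iff] at hns
    obtain ⟨k, hk, l, hl, hkl⟩ := hns
    wlog hlt : (k : ℕ) < l generalizing k l
    · exact this l hl k hk hkl.symm
        (lt_of_le_of_ne (not_lt.1 hlt) fun h => hkl (Fin.ext h.symm))
    have hadj := adjacent_of_active hn hε hsmall ((mem_polygon_iff heven hε).1 hy.1) hlt l.2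
      ((mem_active_iff heven hε).1 hk) ((mem_active_iff heven hε).1 hl)
    obtain ⟨i, hi1, hi2⟩ : ∃ i, i ∈ active (rowV n ε) (rhs n ε) y ∧
        σ i ∈ active (rowV n ε) (rhs n ε) y := by
      rcases hadj with h | ⟨h, h'⟩
      · refine ⟨k, hk, ?_⟩
        have : σ k = l := Fin.ext (by have := hσ k; have := l.2; omega)
        rwa [this]
      · refine ⟨l, hl, ?_⟩
        have : σ l = k := Fin.ext (by have := hσ l; omega)
        rwa [this]
    refine ⟨i, sub_eq_zero.1 (eq_zero_of_rowV_eq_zero (hdet i) ?_ ?_)⟩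
    · have h1 : rowV n ε i (v i) = rhs n ε i := hact1 i
      have h2 : rowV n ε i y = rhs n ε i := hi1
      simp [h1, h2]
    · have h1 : rowV n ε (σ i) (v i) = rhs n ε (σ i) := hact2 i
      have h2 : rowV n ε (σ i) y = rhs n ε (σ i) := hi2
      simp [h1, h2]
  refine ⟨v, ?_, ?_⟩
  · have h := (convex_polyhedron (rowV n ε) (rhs n ε)).convexIndependent_extremePoints
    exact h.comp_embedding
      ⟨fun i => ⟨v i, hext i⟩, fun i j hij => hinj (congrArg Subtype.val hij)⟩
  · rw [hsurj]
    exact polyhedron_eq_convexHull_extremePoints (isBounded_polyhedron_rowV hn heven hε _)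

/-! ### The positive dependence in the limit `ε → 0` -/

/-- Summation by parts: a pair `α, β` of coefficient sequences that satisfies the two recurrences
annihilates the rows of the limit matrix, up to boundary terms. -/
theorem sum_limit_rows {α β p q : ℕ → ℝ} (hp0 : p 0 = 0) (hp1 : p 1 = 0) (hq0 : q 0 = 0)
    (h1 : ∀ k, α k - 3 * β (k + 1) - 31 / 4 * α (k + 2) + 9 * β (k + 2) = 0)
    (h2 : ∀ k, α k - 2 / 3 * β k + 1 / 2 * α (k + 1) - 2 / 3 * β (k + 1) = 0) (N : ℕ) :
    ∑ k ∈ Finset.range N,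
      (α k * (p (k + 2) + q (k + 1) - 31 / 4 * p k + 1 / 2 * q k) +
        β k * (-3 * p (k + 1) - 2 / 3 * q (k + 1) + 9 * p k - 2 / 3 * q k)) =
      (31 / 4 * α N - 9 * β N) * p N + (3 * β N + 31 / 4 * α (N + 1) - 9 * β (N + 1)) * p (N + 1) -
        (1 / 2 * α N - 2 / 3 * β N) * q N := by
  induction N with
  | zero => simp [hp0, hp1, hq0]
  | succ N ih =>
    rw [Finset.sum_range_succ, ih]
    linear_combination p (N + 2) * h1 N + q (N + 1) * h2 N

/-- In the limit `ε → 0`, the truncated rows of all blocks but the `k₀`-th positively span. The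
recurrences for the coefficients of a linear dependence have the characteristic roots `1/2, 1, 2`;
the solution with a double zero at `k₀` is positive elsewhere. The sequences `p, q` hold the two
coordinates of the blocks, with two zero blocks put in front. -/
theorem eq_zero_of_limit_rows_nonpos {r k₀ : ℕ} (hk₀ : k₀ < r) {p q : ℕ → ℝ} (hp0 : p 0 = 0)
    (hp1 : p 1 = 0) (hq0 : q 0 = 0) (hp : ∀ j, r ≤ j → p j = 0)
    (hq : ∀ j, r ≤ j → q j = 0)
    (hE : ∀ k < r, k ≠ k₀ → p (k + 2) + q (k + 1) - 31 / 4 * p k + 1 / 2 * q k ≤ 0)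
    (hO : ∀ k < r, k ≠ k₀ → -3 * p (k + 1) - 2 / 3 * q (k + 1) + 9 * p k - 2 / 3 * q k ≤ 0)
    (j : ℕ) : p j = 0 ∧ q j = 0 := by
  set u : ℕ → ℝ := fun k => 2 ^ k / 2 ^ k₀ with hu
  set w : ℕ → ℝ := fun k => 2 ^ k₀ / 2 ^ k with hw
  have hu' : ∀ k, u (k + 1) = 2 * u k := fun k => by simp only [hu, pow_succ]; ring
  have hw' : ∀ k, w k = 2 * w (k + 1) := fun k => by simp only [hw, pow_succ]; field_simp
  have hupos : ∀ k, 0 < u k := fun k => by positivity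
  have hwpos : ∀ k, 0 < w k := fun k => by positivity
  have huw : ∀ k, u k * w k = 1 := fun k => by simp only [hu, hw]; field_simp
  have hcase : ∀ k, k ≠ k₀ → 2 ≤ u k ∨ u k ≤ 1 / 2 := by
    intro k hk
    have hb : (0 : ℝ) < 2 ^ k₀ := by positivity
    rcases lt_or_gt_of_ne hk with h | h
    · right
      have : (2 : ℝ) ^ (k + 1) ≤ 2 ^ k₀ := pow_le_pow_right₀ (by norm_num) h
      rw [pow_succ] at this
      simp only [hu]
      rw [div_le_iff₀ hb]; linarith
    · left
      have : (2 : ℝ) ^ (k₀ + 1) ≤ 2 ^ k := pow_le_pow_right₀ (by norm_num) h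
      rw [pow_succ] at this
      simp only [hu]
      rw [le_div_iff₀ hb]; linarith
  -- the geometric solutions of the recurrences are `(1, 1)`, `(1, 9/8)`, `(1, 5/4)` times the powers
  -- of `2`, `1`, `1/2`; the weights `1, -2, 1` make both sequences vanish at `k₀`
  set α : ℕ → ℝ := fun k => u k - 2 + w k with hα
  set β : ℕ → ℝ := fun k => u k - 9 / 4 + 5 / 4 * w k with hβ
  have hαpos : ∀ k, k ≠ k₀ → 0 < α k := by
    intro k hk
    have : α k = (u k - 1) ^ 2 * w k := by
      simp only [hα]; linear_combination (2 - u k) * huw k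
    rw [this]
    refine mul_pos (sq_pos_iff.2 ?_) (hwpos k)
    rcases hcase k hk with h | h <;> intro h0 <;> linarith
  have hβpos : ∀ k, k ≠ k₀ → 0 < β k := by
    intro k hk
    have : β k = (u k - 1) * (u k - 5 / 4) * w k := by
      simp only [hβ]; linear_combination (9 / 4 - u k) * huw k
    rw [this]
    refine mul_pos ?_ (hwpos k)
    rcases hcase k hk with h | h
    · exact mul_pos (by linarith) (by linarith)
    · exact mul_pos_of_neg_of_neg (by linarith) (by linarith)
  have hα0 : α k₀ = 0 := by simp [hα, hu, hw]; norm_num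
  have hβ0 : β k₀ = 0 := by simp [hβ, hu, hw]; norm_num
  have hsum := sum_limit_rows (α := α) (β := β) hp0 hp1 hq0
    (fun k => by
      simp only [hα, hβ]
      linear_combination (-3) * hu' k - 31 / 4 * hu' (k + 1) + 9 * hu' (k + 1) +
        5 / 2 * hu' k + hw' k + (2 - 15 / 4) * hw' (k + 1))
    (fun k => by
      simp only [hα, hβ]
      linear_combination -1 / 6 * hu' k + 1 / 6 * hw' k) r
  rw [hp r le_rfl, hp (r + 1) (by omega), hq r le_rfl] at hsum
  simp only [mul_zero, add_zero, sub_zero] at hsum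
  have hterm : ∀ k < r, α k * (p (k + 2) + q (k + 1) - 31 / 4 * p k + 1 / 2 * q k) ≤ 0 ∧
      β k * (-3 * p (k + 1) - 2 / 3 * q (k + 1) + 9 * p k - 2 / 3 * q k) ≤ 0 := by
    intro k hk
    by_cases h : k = k₀
    · subst h; simp [hα0, hβ0]
    · exact ⟨mul_nonpos_of_nonneg_of_nonpos (hαpos k h).le (hE k hk h),
        mul_nonpos_of_nonneg_of_nonpos (hβpos k h).le (hO k hk h)⟩
  have hzero := (Finset.sum_eq_zero_iff_of_nonpos fun k hk => by
    have := hterm k (Finset.mem_range.1 hk)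
    linarith [this.1, this.2]).1 hsum
  have hE0 : ∀ k < r, k ≠ k₀ → p (k + 2) + q (k + 1) - 31 / 4 * p k + 1 / 2 * q k = 0 := by
    intro k hk h
    have h1 := hzero k (Finset.mem_range.2 hk)
    have h2 := hterm k hk
    have h3 : α k * (p (k + 2) + q (k + 1) - 31 / 4 * p k + 1 / 2 * q k) = 0 := by
      linarith [h2.1, h2.2]
    exact (mul_eq_zero.1 h3).resolve_left (hαpos k h).ne'
  have hO0 : ∀ k < r, k ≠ k₀ →
      -3 * p (k + 1) - 2 / 3 * q (k + 1) + 9 * p k - 2 / 3 * q k = 0 := by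
    intro k hk h
    have h1 := hzero k (Finset.mem_range.2 hk)
    have h2 := hterm k hk
    have h3 : β k * (-3 * p (k + 1) - 2 / 3 * q (k + 1) + 9 * p k - 2 / 3 * q k) = 0 := by
      linarith [h2.1, h2.2]
    exact (mul_eq_zero.1 h3).resolve_left (hβpos k h).ne'
  -- blocks before the gap vanish by forward substitution
  have hfwd : ∀ k ≤ k₀, p k = 0 ∧ q k = 0 ∧ p (k + 1) = 0 := by
    intro k
    induction k with
    | zero => exact fun _ => ⟨hp0, hq0, hp1⟩
    | succ k ih =>
      intro hk
      obtain ⟨a1, a2, a3⟩ := ih (by omega)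
      have e1 := hE0 k (by omega) (by omega)
      have e2 := hO0 k (by omega) (by omega)
      rw [a1, a2, a3] at e2
      have a4 : q (k + 1) = 0 := by linarith
      rw [a1, a2, a4] at e1
      exact ⟨a3, a4, by linarith⟩
  -- blocks after the gap vanish by backward substitution, as the `2 × 2` block of `W` is regular
  have hbwd : ∀ d k, k + d = r → k₀ < k → ∀ j, k ≤ j → p j = 0 ∧ q j = 0 := by
    intro d
    induction d with
    | zero => exact fun k hk _ j hj => ⟨hp j (by omega), hq j (by omega)⟩
    | succ d ih =>
      intro k hk hk' j hj
      have hnext := ih (k + 1) (by omega) (by omega)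
      rcases Nat.eq_or_lt_of_le hj with rfl | h
      · have e1 := hE0 k (by omega) (by omega)
        have e2 := hO0 k (by omega) (by omega)
        rw [(hnext (k + 2) (by omega)).1, (hnext (k + 1) le_rfl).2] at e1
        rw [(hnext (k + 1) le_rfl).1, (hnext (k + 1) le_rfl).2] at e2
        constructor <;> linarith
      · exact hnext j h
  rcases Nat.lt_or_ge k₀ j with h | h
  · exact hbwd (r - (k₀ + 1)) (k₀ + 1) (by omega) (by omega) j h
  · exact ⟨(hfwd j h).1, (hfwd j h).2.1⟩

/-! ### The block structure of the deformed product -/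

/-- The blocks `x_k ∈ ℝ²` of `x ∈ ℝ^{2r}`, with the index shifted by two: `shiftedBlock r (k + 2)`
is the `k`-th block, and the blocks with indices `0`, `1` and from `r + 2` on are zero. -/
def shiftedBlock (r j : ℕ) : (Fin (2 * r) → ℝ) →ₗ[ℝ] (Fin 2 → ℝ) :=
  if h : 2 ≤ j ∧ j < r + 2 then
    LinearMap.funLeft ℝ ℝ fun t : Fin 2 => (⟨2 * (j - 2) + t, by omega⟩ : Fin (2 * r))
  else 0

theorem shiftedBlock_apply {r k : ℕ} (hk : k < r) (x : Fin (2 * r) → ℝ) (t : Fin 2) :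
    shiftedBlock r (k + 2) x t = x ⟨2 * k + t, by omega⟩ := by
  rw [shiftedBlock, dif_pos ⟨by omega, by omega⟩]
  rfl

theorem shiftedBlock_of_lt {r j : ℕ} (hj : j < 2) (x : Fin (2 * r) → ℝ) :
    shiftedBlock r j x = 0 := by
  rw [shiftedBlock, dif_neg (by omega)]; rfl

theorem shiftedBlock_of_le {r j : ℕ} (hj : r + 2 ≤ j) (x : Fin (2 * r) → ℝ) :
    shiftedBlock r j x = 0 := by
  rw [shiftedBlock, dif_neg (by omega)]; rfl

theorem apply_eq_shiftedBlock {r : ℕ} (x : Fin (2 * r) → ℝ) (c : Fin (2 * r)) :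
    x c = shiftedBlock r (c / 2 + 2) x ⟨c % 2, Nat.mod_lt _ Nat.two_pos⟩ := by
  rw [shiftedBlock_apply (by omega)]
  congr 1
  ext
  simp only
  omega

theorem norm_shiftedBlock_le (r j : ℕ) (x : Fin (2 * r) → ℝ) : ‖shiftedBlock r j x‖ ≤ ‖x‖ := by
  by_cases h : 2 ≤ j ∧ j < r + 2
  · rw [shiftedBlock, dif_pos h]
    exact (pi_norm_le_iff_of_nonneg (norm_nonneg _)).2 fun t => norm_le_pi_norm x _
  · rw [shiftedBlock, dif_neg h]; simp

/-- The rows of the coefficient matrix as linear functionals. -/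
noncomputable def coeffRow (n r : ℕ) (ε : ℝ) (ki : Fin r × Fin n) : (Fin (2 * r) → ℝ) →ₗ[ℝ] ℝ :=
  LinearMap.proj ki ∘ₗ (coeff n r ε).mulVecLin

theorem coeffRow_apply (n r : ℕ) (ε : ℝ) (k : Fin r) (i : Fin n) (x : Fin (2 * r) → ℝ) :
    coeffRow n r ε (k, i) x = rowV n ε i (shiftedBlock r (k + 2) x) +
      rowFun (blockU n) i (shiftedBlock r (k + 1) x) + rowFun (blockW n) i (shiftedBlock r k x) := by
  have h1 : coeffRow n r ε (k, i) x = ∑ c, coeff n r ε (k, i) c * x c := rfl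
  have h2 : ∀ j : Fin r, ∑ t : Fin 2, coeff n r ε (k, i) ⟨2 * j + t, by omega⟩ *
      x ⟨2 * j + t, by omega⟩ =
      (if (k : ℕ) = j then rowV n ε i (shiftedBlock r (j + 2) x) else 0) +
      (if (k : ℕ) = j + 1 then rowFun (blockU n) i (shiftedBlock r (j + 2) x) else 0) +
      (if (k : ℕ) = j + 2 then rowFun (blockW n) i (shiftedBlock r (j + 2) x) else 0) := by
    intro j
    have a1 : (2 * (j : ℕ) + 1) / 2 = j := by omega
    have a2 : (2 * (j : ℕ) + 1) % 2 = 1 := by omega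
    rw [Fin.sum_univ_two, rowV_apply, rowFun_apply, rowFun_apply]
    simp only [shiftedBlock_apply j.2, coeff, Fin.val_zero, Fin.val_one, add_zero, a1, a2,
      Nat.mul_div_cancel_left _ Nat.two_pos, Nat.mul_mod_right]
    by_cases c1 : (k : ℕ) = j
    · simp [c1]
    · by_cases c2 : (k : ℕ) = j + 1
      · simp [c2]
      · by_cases c3 : (k : ℕ) = j + 2 <;> simp [c1, c2, c3]
  have h3 : ∑ c, coeff n r ε (k, i) c * x c = ∑ j : Fin r, ∑ t : Fin 2,
      coeff n r ε (k, i) ⟨2 * j + t, by omega⟩ * x ⟨2 * j + t, by omega⟩ := by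
    rw [← Fintype.sum_prod_type' (f := fun (j : Fin r) (t : Fin 2) =>
      coeff n r ε (k, i) ⟨2 * j + t, by omega⟩ * x ⟨2 * j + t, by omega⟩)]
    symm
    refine Fintype.sum_equiv (finProdFinEquiv.trans (finCongr (mul_comm r 2))) _ _ fun jt => ?_
    have : (finProdFinEquiv.trans (finCongr (mul_comm r 2))) jt =
        ⟨2 * jt.1 + jt.2, by omega⟩ := by
      ext
      simp [finProdFinEquiv, add_comm]
    rw [this]
  rw [h1, h3, Finset.sum_congr rfl fun j _ => h2 j, Finset.sum_add_distrib,
    Finset.sum_add_distrib]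
  have hk := k.2
  congr 1
  · congr 1
    · rw [Finset.sum_eq_single k (fun j _ hj => if_neg fun h => hj (Fin.ext h.symm)) (by simp),
        if_pos rfl]
    · rcases Nat.eq_zero_or_pos (k : ℕ) with h0 | h0
      · rw [shiftedBlock_of_lt (by omega), map_zero]
        exact Finset.sum_eq_zero fun j _ => if_neg (by omega)
      · rw [Finset.sum_eq_single ⟨k - 1, by omega⟩
          (fun j _ hj => if_neg fun h => hj (Fin.ext (by simp only; omega))) (by simp),
          if_pos (by simp only; omega)]
        have : (k : ℕ) - 1 + 2 = k + 1 := by omega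
        simp only [this]
  · rcases Nat.lt_or_ge (k : ℕ) 2 with h0 | h0
    · rw [shiftedBlock_of_lt (by omega), map_zero]
      exact Finset.sum_eq_zero fun j _ => if_neg (by omega)
    · rw [Finset.sum_eq_single ⟨k - 2, by omega⟩
        (fun j _ hj => if_neg fun h => hj (Fin.ext (by simp only; omega))) (by simp),
        if_pos (by simp only; omega)]
      have : (k : ℕ) - 2 + 2 = k := by omega
      simp only [this]

theorem shiftedBlock_eq_zero_of_lastFour {r : ℕ} (hr : 2 ≤ r) {x : Fin (2 * r) → ℝ}
    (hx : lastFour r hr x = 0) {j : ℕ} (hj : r ≤ j) : shiftedBlock r j x = 0 := by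
  rcases Nat.lt_or_ge j (r + 2) with h | h
  · obtain ⟨k, rfl⟩ : ∃ k, j = k + 2 := ⟨j - 2, by omega⟩
    ext t
    rw [shiftedBlock_apply (by omega)]
    have h1 := congrFun hx ⟨2 * k + t - (2 * r - 4), by omega⟩
    have h2 : (⟨2 * r - 4 + (2 * k + t - (2 * r - 4)), by omega⟩ : Fin (2 * r)) =
        ⟨2 * k + t, by omega⟩ := by
      ext; simp only; omega
    rw [← h2]
    exact h1
  · exact shiftedBlock_of_le h x

/-- The limit for `ε → 0` of the rows of the `k`-th block with even (`true`) or odd (`false`)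
index. -/
noncomputable def limitRow (r k : ℕ) : Bool → (Fin (2 * r) → ℝ) →ₗ[ℝ] ℝ
  | true => LinearMap.proj 0 ∘ₗ shiftedBlock r (k + 2) + LinearMap.proj 1 ∘ₗ shiftedBlock r (k + 1)
      - (31 / 4 : ℝ) • (LinearMap.proj 0 ∘ₗ shiftedBlock r k)
      + (1 / 2 : ℝ) • (LinearMap.proj 1 ∘ₗ shiftedBlock r k)
  | false => (-3 : ℝ) • (LinearMap.proj 0 ∘ₗ shiftedBlock r (k + 1))
      - (2 / 3 : ℝ) • (LinearMap.proj 1 ∘ₗ shiftedBlock r (k + 1))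
      + (9 : ℝ) • (LinearMap.proj 0 ∘ₗ shiftedBlock r k)
      - (2 / 3 : ℝ) • (LinearMap.proj 1 ∘ₗ shiftedBlock r k)

theorem exists_limitRow_pos {r : ℕ} (hr : 2 ≤ r) (k₀ : Fin r) {x : Fin (2 * r) → ℝ}
    (hx : lastFour r hr x = 0) (hx0 : x ≠ 0) :
    ∃ kb : {k : Fin r // k ≠ k₀} × Bool, 0 < limitRow r kb.1 kb.2 x := by
  by_contra! hcon
  have hz : ∀ j, j < 2 ∨ r ≤ j → shiftedBlock r j x = 0 := fun j hj =>
    hj.elim (fun h => shiftedBlock_of_lt h x) fun h => shiftedBlock_eq_zero_of_lastFour hr hx h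
  have key := eq_zero_of_limit_rows_nonpos k₀.2 (p := fun j => shiftedBlock r j x 0)
    (q := fun j => shiftedBlock r j x 1) (by simp [hz 0]) (by simp [hz 1]) (by simp [hz 0])
    (fun j hj => by simp [hz j (Or.inr hj)]) (fun j hj => by simp [hz j (Or.inr hj)])
    (fun k hk hne => by
      simpa [limitRow] using hcon ⟨⟨⟨k, hk⟩, fun h => hne (by rw [← h])⟩, true⟩)
    (fun k hk hne => by
      simpa [limitRow] using hcon ⟨⟨⟨k, hk⟩, fun h => hne (by rw [← h])⟩, false⟩)
  apply hx0
  ext c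
  rw [apply_eq_shiftedBlock x c]
  have := key (c / 2 + 2)
  rcases Nat.mod_two_eq_zero_or_one c with h | h <;> simp only [h]
  · exact this.1
  · exact this.2

theorem abs_rowV_sub_le {n : ℕ} (heven : Even n) {ε : ℝ} (hε : 0 < ε) (hε1 : ε ≤ 1)
    (i : Fin n) (y : Fin 2 → ℝ) :
    |rowV n ε i y - if Even (i : ℕ) then y 0 else 0| ≤ ε * (3 * n ^ 2) * ‖y‖ := by
  have hn1 : (1 : ℝ) ≤ n := by exact_mod_cast (by have := i.2; omega : 1 ≤ n)
  have h0 : |y 0| ≤ ‖y‖ := norm_le_pi_norm y 0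
  have h1 : |y 1| ≤ ‖y‖ := norm_le_pi_norm y 1
  have hy := norm_nonneg y
  have hnn : (n : ℝ) ≤ n ^ 2 := by nlinarith
  have hn0 : (0 : ℝ) ≤ (n : ℝ) ^ 2 := by positivity
  by_cases hin : (i : ℕ) + 1 = n
  · have h2 : ¬ Even (i : ℕ) := by rw [← hin] at heven; exact Nat.even_add_one.1 heven
    have e : rowV n ε i y - (if Even (i : ℕ) then y 0 else 0) = -(ε * y 0) := by
      rw [rowV_apply]; simp [blockV, hin, h2]
    rw [e, abs_neg, abs_mul, abs_of_pos hε, mul_assoc]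
    refine mul_le_mul_of_nonneg_left ?_ hε.le
    nlinarith
  · have hi' : (i : ℝ) + 1 + 1 ≤ n := by
      exact_mod_cast (by have := i.2; omega : (i : ℕ) + 1 + 1 ≤ n)
    have hi0 : (0 : ℝ) ≤ (i : ℕ) := by positivity
    have hs : |(n : ℝ) - 2 - 2 * (i : ℕ)| ≤ n := abs_le.2 ⟨by linarith, by linarith⟩
    have hsq : ((n : ℝ) - 2 - 2 * (i : ℕ)) ^ 2 ≤ n ^ 2 := sq_le_sq' (abs_le.1 hs).1 (abs_le.1 hs).2
    generalize hsdef : (n : ℝ) - 2 - 2 * (i : ℕ) = s at hs hsq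
    have b0 : |s ^ 2 * y 0| ≤ n ^ 2 * ‖y‖ := by
      rw [abs_mul, abs_of_nonneg (sq_nonneg s)]
      exact mul_le_mul hsq h0 (abs_nonneg _) hn0
    have b1 : |s * y 1| ≤ n ^ 2 * ‖y‖ := by
      rw [abs_mul]
      exact mul_le_mul (hs.trans hnn) h1 (abs_nonneg _) hn0
    have b2 : ‖y‖ ≤ n ^ 2 * ‖y‖ := by nlinarith
    by_cases h2 : Even (i : ℕ)
    · have e : rowV n ε i y - (if Even (i : ℕ) then y 0 else 0) =
          ε * (s * y 1 - s ^ 2 * y 0) := by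
        rw [rowV_apply]; simp [blockV, hin, h2, hsdef]; ring
      rw [e, abs_mul, abs_of_pos hε, mul_assoc]
      refine mul_le_mul_of_nonneg_left ?_ hε.le
      have := abs_sub (s * y 1) (s ^ 2 * y 0)
      nlinarith
    · have e : rowV n ε i y - (if Even (i : ℕ) then y 0 else 0) =
          ε * (y 0 + ε * (s * y 1 - s ^ 2 * y 0)) := by
        rw [rowV_apply]; simp [blockV, hin, h2, hsdef]; ring
      rw [e, abs_mul, abs_of_pos hε, mul_assoc]
      refine mul_le_mul_of_nonneg_left ?_ hε.le
      have t1 := abs_sub (s * y 1) (s ^ 2 * y 0)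
      have t2 := abs_add_le (y 0) (ε * (s * y 1 - s ^ 2 * y 0))
      rw [abs_mul ε, abs_of_pos hε] at t2
      have t3 : ε * |s * y 1 - s ^ 2 * y 0| ≤ |s * y 1 - s ^ 2 * y 0| :=
        mul_le_of_le_one_left (abs_nonneg _) hε1
      linarith

theorem limitRow_sub_le_coeffRow {n : ℕ} (heven : Even n) {ε : ℝ} (hε : 0 < ε) (hε1 : ε ≤ 1)
    {r : ℕ} (k : Fin r) (i : Fin n) (x : Fin (2 * r) → ℝ) :
    limitRow r k (decide (Even (i : ℕ))) x - ε * (3 * n ^ 2) * ‖x‖ ≤ coeffRow n r ε (k, i) x := by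
  have h1 := (abs_le.1 (abs_rowV_sub_le heven hε hε1 i (shiftedBlock r (k + 2) x))).1
  have h2 : ε * (3 * n ^ 2) * ‖shiftedBlock r (k + 2) x‖ ≤ ε * (3 * n ^ 2) * ‖x‖ :=
    mul_le_mul_of_nonneg_left (norm_shiftedBlock_le _ _ _) (by positivity)
  rw [coeffRow_apply, rowFun_apply, rowFun_apply]
  by_cases h : Even (i : ℕ)
  · simp only [h, if_true, decide_true, limitRow, blockU, blockW, LinearMap.add_apply,
      LinearMap.sub_apply, LinearMap.smul_apply, LinearMap.comp_apply, LinearMap.proj_apply,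
      smul_eq_mul, Matrix.cons_val_zero, Matrix.cons_val_one] at h1 ⊢
    linarith
  · simp only [h, if_false, decide_false, limitRow, blockU, blockW, LinearMap.add_apply,
      LinearMap.sub_apply, LinearMap.smul_apply, LinearMap.comp_apply, LinearMap.proj_apply,
      smul_eq_mul, Matrix.cons_val_zero, Matrix.cons_val_one] at h1 ⊢
    linarith

/-- For small `ε`, one even and one odd row from each block but the `k₀`-th suffice to positively
span the dual of the kernel of the projection. -/
theorem eventually_exists_coeffRow_pos {n r : ℕ} (heven : Even n) (hr : 2 ≤ r) :
    ∀ᶠ ε : ℝ in 𝓝[>] 0, ∀ (k₀ : Fin r) (x : Fin (2 * r) → ℝ), lastFour r hr x = 0 → x ≠ 0 →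
      ∀ e o : Fin r → Fin n, (∀ k, Even (e k : ℕ)) → (∀ k, Odd (o k : ℕ)) →
        ∃ k, k ≠ k₀ ∧ (0 < coeffRow n r ε (k, e k) x ∨ 0 < coeffRow n r ε (k, o k) x) := by
  rw [eventually_all]
  intro k₀
  obtain ⟨δ, hδ, h⟩ := exists_pos_mul_norm_le
    (fun kb : {k : Fin r // k ≠ k₀} × Bool => limitRow r kb.1 kb.2)
    (LinearMap.ker (lastFour r hr)) fun x hx hx0 => exists_limitRow_pos hr k₀ hx hx0
  -- the rows differ from their limits by at most `ε * (3 * n ^ 2)` in norm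
  have hsmall : ∀ᶠ ε : ℝ in 𝓝[>] 0, ε * (3 * n ^ 2) < δ := by
    have hc : Continuous fun ε : ℝ => ε * (3 * (n : ℝ) ^ 2) := by fun_prop
    exact (hc.continuousAt.eventually_lt continuousAt_const (by simpa using hδ)).filter_mono
      nhdsWithin_le_nhds
  have hone : ∀ᶠ ε : ℝ in 𝓝[>] 0, ε ≤ 1 :=
    (eventually_le_nhds one_pos).filter_mono nhdsWithin_le_nhds
  filter_upwards [hsmall, hone, self_mem_nhdsWithin] with ε h1 h2 hpos x hx hx0 e o he ho
  have hpos : 0 < ε := hpos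
  obtain ⟨⟨⟨k, hk⟩, t⟩, hkt⟩ := h x hx hx0
  have hn : 0 < ‖x‖ := norm_pos_iff.2 hx0
  have h3 : ε * (3 * n ^ 2) * ‖x‖ < δ * ‖x‖ := mul_lt_mul_of_pos_right h1 hn
  refine ⟨k, hk, ?_⟩
  cases t
  · right
    have h4 := limitRow_sub_le_coeffRow heven hpos h2 k (o k) x
    rw [decide_eq_false (Nat.not_even_iff_odd.2 (ho k))] at h4
    simp only at hkt
    linarith
  · left
    have h4 := limitRow_sub_le_coeffRow heven hpos h2 k (e k) x
    rw [decide_eq_true (he k)] at h4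
    simp only at hkt
    linarith

/-! ### The active sets of the deformed product -/

/-- The `k`-th block of a set of rows. -/
def slice {r n : ℕ} (J : Set (Fin r × Fin n)) (k : Fin r) : Set (Fin n) := {i | (k, i) ∈ J}

theorem slice_injective {r n : ℕ} : Function.Injective (slice (r := r) (n := n)) := by
  intro J J' h
  ext ⟨k, i⟩
  exact Set.ext_iff.1 (congrFun h k) i

/-- The inequalities of the product as linear functionals. -/
noncomputable def productRow (n r : ℕ) (ε : ℝ) (ki : Fin r × Fin n) :
    (Fin r → Fin 2 → ℝ) →ₗ[ℝ] ℝ :=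
  rowV n ε ki.2 ∘ₗ LinearMap.proj ki.1

theorem product_eq_polyhedron (n r : ℕ) (ε : ℝ) :
    product n r ε = polyhedron (productRow n r ε) fun ki => rhs n ε ki.2 := by
  ext y
  exact ⟨fun h ki => h ki.1 trivial ki.2, fun h k _ i => h (k, i)⟩

theorem deformedProduct_eq_polyhedron (n r : ℕ) (ε M : ℝ) :
    deformedProduct n r ε M =
      polyhedron (coeffRow n r ε) fun ki => M ^ (ki.1 : ℕ) * rhs n ε ki.2 := rfl

theorem mem_activeSets_product {n r : ℕ} {ε : ℝ} {J : Set (Fin r × Fin n)} :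
    J ∈ activeSets (productRow n r ε) (fun ki => rhs n ε ki.2) ↔
      ∀ k, slice J k ∈ activeSets (rowV n ε) (rhs n ε) := by
  constructor
  · rintro ⟨y, hy, rfl⟩ k
    exact ⟨y k, fun i => hy (k, i), rfl⟩
  · intro h
    choose y hy hact using h
    exact ⟨y, fun ki => hy ki.1 ki.2, slice_injective (funext hact)⟩

/-- Scaling the right-hand side does not change the active sets. -/
theorem activeSets_smul {ι E : Type*} [AddCommGroup E] [Module ℝ E] (a : ι → E →ₗ[ℝ] ℝ)
    (c : ι → ℝ) {t : ℝ} (ht : 0 < t) : activeSets a (fun i => t * c i) = activeSets a c := by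
  ext J
  constructor
  · rintro ⟨y, hy, rfl⟩
    refine ⟨t⁻¹ • y, fun i => ?_, ?_⟩
    · rw [map_smul, smul_eq_mul, inv_mul_le_iff₀ ht]
      exact hy i
    · ext i
      simp only [active, Set.mem_ofPred_eq, map_smul, smul_eq_mul]
      rw [inv_mul_eq_iff_eq_mul₀ ht.ne']
  · rintro ⟨y, hy, rfl⟩
    refine ⟨t • y, fun i => ?_, ?_⟩
    · simpa using mul_le_mul_of_nonneg_left (hy i) ht.le
    · ext i
      simp [active, ht.ne']

/-- The right-hand side left over for the `k`-th block of the deformed product when the preceding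
two blocks are `w` and `u`. -/
noncomputable def blockRhs (n : ℕ) (ε M : ℝ) (k : ℕ) (u w : Fin 2 → ℝ) (i : Fin n) : ℝ :=
  M ^ k * rhs n ε i - rowFun (blockU n) i u - rowFun (blockW n) i w

theorem mem_deformedProduct_iff {n r : ℕ} {ε M : ℝ} {x : Fin (2 * r) → ℝ} :
    x ∈ polyhedron (coeffRow n r ε) (fun ki => M ^ (ki.1 : ℕ) * rhs n ε ki.2) ↔
      ∀ k : Fin r, shiftedBlock r (k + 2) x ∈ polyhedron (rowV n ε)
        (blockRhs n ε M k (shiftedBlock r (k + 1) x) (shiftedBlock r k x)) := by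
  constructor
  · intro h k i
    have := h (k, i)
    rw [coeffRow_apply] at this
    unfold blockRhs
    linarith
  · rintro h ⟨k, i⟩
    have := h k i
    unfold blockRhs at this
    rw [coeffRow_apply]
    linarith

theorem slice_active {n r : ℕ} {ε M : ℝ} (x : Fin (2 * r) → ℝ) (k : Fin r) :
    slice (active (coeffRow n r ε) (fun ki => M ^ (ki.1 : ℕ) * rhs n ε ki.2) x) k =
      active (rowV n ε) (blockRhs n ε M k (shiftedBlock r (k + 1) x) (shiftedBlock r k x))
        (shiftedBlock r (k + 2) x) := by
  ext i
  change coeffRow n r ε (k, i) x = M ^ (k : ℕ) * rhs n ε i ↔ rowV n ε i _ = blockRhs _ _ _ _ _ _ i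
  rw [coeffRow_apply]
  unfold blockRhs
  constructor <;> intro h <;> linarith

theorem exists_shiftedBlock_eq {r : ℕ} (Z : ℕ → Fin 2 → ℝ) (h0 : Z 0 = 0) (h1 : Z 1 = 0) :
    ∃ x : Fin (2 * r) → ℝ, ∀ j < r + 2, shiftedBlock r j x = Z j := by
  refine ⟨fun c => Z (c / 2 + 2) ⟨c % 2, Nat.mod_lt _ Nat.two_pos⟩, fun j hj => ?_⟩
  rcases Nat.lt_or_ge j 2 with h | h
  · rw [shiftedBlock_of_lt h]
    interval_cases j
    · exact h0.symm
    · exact h1.symm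
  · obtain ⟨k, rfl⟩ : ∃ k, j = k + 2 := ⟨j - 2, by omega⟩
    ext t
    rw [shiftedBlock_apply (by omega)]
    have e1 : (2 * k + (t : ℕ)) / 2 = k := by omega
    have e2 : (⟨(2 * k + (t : ℕ)) % 2, Nat.mod_lt _ Nat.two_pos⟩ : Fin 2) = t := by
      ext; simp only; omega
    simp only [e1, e2]

theorem exists_abs_rowFun_le {n : ℕ} (A : Matrix (Fin n) (Fin 2) ℝ) :
    ∃ D : ℝ, 0 ≤ D ∧ ∀ i y, |rowFun A i y| ≤ D * ‖y‖ := by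
  refine ⟨∑ i, (|A i 0| + |A i 1|), by positivity, fun i y => ?_⟩
  have h0 : |y 0| ≤ ‖y‖ := norm_le_pi_norm y 0
  have h1 : |y 1| ≤ ‖y‖ := norm_le_pi_norm y 1
  have h2 : |A i 0| + |A i 1| ≤ ∑ i, (|A i 0| + |A i 1|) :=
    Finset.single_le_sum (f := fun i => |A i 0| + |A i 1|) (fun i _ => by positivity)
      (Finset.mem_univ i)
  rw [rowFun_apply]
  calc |A i 0 * y 0 + A i 1 * y 1| ≤ |A i 0 * y 0| + |A i 1 * y 1| := abs_add_le _ _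
    _ = |A i 0| * |y 0| + |A i 1| * |y 1| := by rw [abs_mul, abs_mul]
    _ ≤ |A i 0| * ‖y‖ + |A i 1| * ‖y‖ := by gcongr
    _ = (|A i 0| + |A i 1|) * ‖y‖ := by ring
    _ ≤ _ := mul_le_mul_of_nonneg_right h2 (norm_nonneg _)

/-- For large `M`, the `k`-th block of the deformed product is a polygon with the active sets of
the original one and of size of order `M ^ k`, provided that the preceding blocks satisfy the same
size bound. -/
theorem exists_block_bound {n : ℕ} (hn : 4 ≤ n) (heven : Even n) {ε : ℝ} (hε : 0 < ε)
    (hsmall : ε * n ^ 2 < 1) :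
    ∃ R : ℝ, 0 ≤ R ∧ ∃ M₀ : ℝ, 1 ≤ M₀ ∧ ∀ M, M₀ < M → ∀ (k : ℕ) (u w : Fin 2 → ℝ),
      ‖u‖ * M ^ 2 ≤ R * M ^ (k + 1) → ‖w‖ * M ^ 2 ≤ R * M ^ k →
      activeSets (rowV n ε) (blockRhs n ε M k u w) = activeSets (rowV n ε) (rhs n ε) ∧
      ∀ y ∈ polyhedron (rowV n ε) (blockRhs n ε M k u w), ‖y‖ * M ^ 2 ≤ R * M ^ (k + 2) := by
  obtain ⟨η, hη, hact⟩ := Metric.eventually_nhds_iff.1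
    (eventually_polygon_activeSets_eq hn heven hε hsmall)
  obtain ⟨B, hB⟩ := (Set.finite_range (rhs n ε)).bddAbove
  obtain ⟨R, hR⟩ := exists_norm_le_of_mem_polyhedron (rowV n ε)
    (fun y hy => exists_rowV_pos hn heven hε hy) (B + η)
  obtain ⟨D₁, hD₁, hU⟩ := exists_abs_rowFun_le (blockU n)
  obtain ⟨D₂, hD₂, hW⟩ := exists_abs_rowFun_le (blockW n)
  refine ⟨max R 0, le_max_right _ _, max 1 ((D₁ + D₂) * max R 0 / η), le_max_left _ _, ?_⟩
  have hS : 0 ≤ max R 0 := le_max_right _ _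
  have hRS : R ≤ max R 0 := le_max_left _ _
  generalize max R 0 = S at hS hRS
  intro M hM k u w hu hw
  have hM1 : 1 < M := (le_max_left _ _).trans_lt hM
  have hM0 : 0 < M := by linarith
  have hM2 : (D₁ + D₂) * S < M * η := by
    rw [← div_lt_iff₀ hη]; exact (le_max_right _ _).trans_lt hM
  have hk : 0 < M ^ k := pow_pos hM0 k
  have hu' : ‖u‖ * M ≤ S * M ^ k := by
    refine le_of_mul_le_mul_right ?_ hM0
    calc ‖u‖ * M * M = ‖u‖ * M ^ 2 := by ring
      _ ≤ S * M ^ (k + 1) := hu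
      _ = S * M ^ k * M := by ring
  have hw' : ‖w‖ * M ≤ S * M ^ k := by
    refine le_trans ?_ hw
    refine mul_le_mul_of_nonneg_left ?_ (norm_nonneg _)
    nlinarith
  -- the rescaled right-hand side is close to that of the polygon
  set c : Fin n → ℝ := fun i => (M ^ k)⁻¹ * blockRhs n ε M k u w i with hc
  have hc' : blockRhs n ε M k u w = fun i => M ^ k * c i := by
    ext i; simp only [hc]; rw [mul_inv_cancel_left₀ hk.ne']
  have hclose : ∀ i, |c i - rhs n ε i| < η := by
    intro i
    have e : c i - rhs n ε i =
        (M ^ k)⁻¹ * -(rowFun (blockU n) i u + rowFun (blockW n) i w) := by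
      simp only [hc, blockRhs]; field_simp; ring
    rw [e, abs_mul, abs_neg, abs_of_pos (inv_pos.2 hk), inv_mul_lt_iff₀ hk]
    refine lt_of_mul_lt_mul_right ?_ hM0.le
    calc |rowFun (blockU n) i u + rowFun (blockW n) i w| * M
        ≤ (D₁ * ‖u‖ + D₂ * ‖w‖) * M :=
          mul_le_mul_of_nonneg_right ((abs_add_le _ _).trans (add_le_add (hU i u) (hW i w))) hM0.le
      _ = D₁ * (‖u‖ * M) + D₂ * (‖w‖ * M) := by ring
      _ ≤ D₁ * (S * M ^ k) + D₂ * (S * M ^ k) := by gcongr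
      _ = (D₁ + D₂) * S * M ^ k := by ring
      _ < M * η * M ^ k := mul_lt_mul_of_pos_right hM2 hk
      _ = M ^ k * η * M := by ring
  constructor
  · rw [hc', activeSets_smul _ _ hk]
    exact hact ((dist_pi_lt_iff hη).2 hclose)
  · intro y hy
    have h1 : ‖(M ^ k)⁻¹ • y‖ ≤ R := by
      refine hR c (fun i => ?_) _ fun i => ?_
      · have h2 := (abs_lt.1 (hclose i)).2
        have h3 : rhs n ε i ≤ B := hB ⟨i, rfl⟩
        linarith
      · rw [map_smul, smul_eq_mul]
        exact mul_le_mul_of_nonneg_left (hy i) (inv_pos.2 hk).le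
    rw [norm_smul, norm_inv, Real.norm_of_nonneg hk.le, inv_mul_le_iff₀ hk] at h1
    calc ‖y‖ * M ^ 2 ≤ M ^ k * R * M ^ 2 := mul_le_mul_of_nonneg_right h1 (by positivity)
      _ ≤ M ^ k * S * M ^ 2 := by gcongr
      _ = S * M ^ (k + 2) := by ring

/-- For large `M` the deformed product is bounded and has the active sets of the product. -/
theorem exists_forall_activeSets_eq {n : ℕ} (hn : 4 ≤ n) (heven : Even n) (r : ℕ) {ε : ℝ}
    (hε : 0 < ε) (hsmall : ε * n ^ 2 < 1) :
    ∃ M₀ : ℝ, ∀ M, M₀ < M →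
      Bornology.IsBounded (polyhedron (coeffRow n r ε)
        fun ki => M ^ (ki.1 : ℕ) * rhs n ε ki.2) ∧
      activeSets (productRow n r ε) (fun ki => rhs n ε ki.2) =
        activeSets (coeffRow n r ε) fun ki => M ^ (ki.1 : ℕ) * rhs n ε ki.2 := by
  obtain ⟨R, hR, M₀, hM₀, h⟩ := exists_block_bound hn heven hε hsmall
  refine ⟨M₀, fun M hM => ?_⟩
  have hM1 : 1 < M := hM₀.trans_lt hM
  have hM0 : 0 < M := by linarith
  have hbound : ∀ x ∈ polyhedron (coeffRow n r ε) (fun ki => M ^ (ki.1 : ℕ) * rhs n ε ki.2),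
      ∀ j, ‖shiftedBlock r j x‖ * M ^ 2 ≤ R * M ^ j := by
    intro x hx j
    rw [mem_deformedProduct_iff] at hx
    induction j using Nat.strong_induction_on with
    | _ j ih =>
      by_cases hj : 2 ≤ j ∧ j < r + 2
      · obtain ⟨k, rfl⟩ : ∃ k, j = k + 2 := ⟨j - 2, by omega⟩
        exact (h M hM k _ _ (ih (k + 1) (by omega)) (ih k (by omega))).2 _ (hx ⟨k, by omega⟩)
      · have : shiftedBlock r j x = 0 := by
          rcases not_and_or.1 hj with h | h
          · exact shiftedBlock_of_lt (by omega) x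
          · exact shiftedBlock_of_le (by omega) x
        rw [this, norm_zero, zero_mul]
        positivity
  constructor
  · refine isBounded_iff_forall_norm_le.2 ⟨R * M ^ (r + 1), fun x hx => ?_⟩
    refine (pi_norm_le_iff_of_nonneg (by positivity)).2 fun c => ?_
    rw [apply_eq_shiftedBlock x c]
    refine (norm_le_pi_norm _ _).trans ?_
    have h1 := hbound x hx (c / 2 + 2)
    have h2 : ‖shiftedBlock r (c / 2 + 2) x‖ ≤ ‖shiftedBlock r (c / 2 + 2) x‖ * M ^ 2 :=
      le_mul_of_one_le_right (norm_nonneg _) (one_le_pow₀ hM1.le)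
    have h3 : M ^ ((c : ℕ) / 2 + 2) ≤ M ^ (r + 1) := pow_le_pow_right₀ hM1.le (by omega)
    exact (h2.trans h1).trans (mul_le_mul_of_nonneg_left h3 hR)
  · ext J
    rw [mem_activeSets_product]
    constructor
    · intro hJ
      -- choose the blocks one after the other
      have key : ∀ N ≤ r, ∃ Z : ℕ → Fin 2 → ℝ, Z 0 = 0 ∧ Z 1 = 0 ∧
          (∀ j < N + 2, ‖Z j‖ * M ^ 2 ≤ R * M ^ j) ∧
          ∀ k : Fin r, (k : ℕ) < N →
            Z (k + 2) ∈ polyhedron (rowV n ε) (blockRhs n ε M k (Z (k + 1)) (Z k)) ∧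
            active (rowV n ε) (blockRhs n ε M k (Z (k + 1)) (Z k)) (Z (k + 2)) = slice J k := by
        intro N
        induction N with
        | zero =>
          refine fun _ => ⟨0, rfl, rfl, fun j _ => ?_, fun k hk => absurd hk (by omega)⟩
          simp only [Pi.zero_apply, norm_zero, zero_mul]
          positivity
        | succ N ih =>
          intro hN
          obtain ⟨Z, h0, h1, hb, hZ⟩ := ih (by omega)
          obtain ⟨ha, hy⟩ := h M hM N (Z (N + 1)) (Z N) (hb _ (by omega)) (hb _ (by omega))
          have hmem := hJ ⟨N, by omega⟩
          rw [← ha] at hmem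
          obtain ⟨y, hyP, hyact⟩ := hmem
          have hne : ∀ j, j < N + 2 → Function.update Z (N + 2) y j = Z j := fun j hj =>
            Function.update_of_ne (by omega) _ _
          refine ⟨Function.update Z (N + 2) y, by rw [hne 0 (by omega), h0],
            by rw [hne 1 (by omega), h1], fun j hj => ?_, fun k hk => ?_⟩
          · rcases Nat.lt_or_ge j (N + 2) with hj' | hj'
            · rw [hne j hj']; exact hb j hj'
            · obtain rfl : j = N + 2 := by omega
              rw [Function.update_self]; exact hy y hyP
          · rw [hne (k + 1) (by omega), hne k (by omega)]
            rcases Nat.lt_or_ge (k : ℕ) N with hk' | hk'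
            · rw [hne (k + 2) (by omega)]; exact hZ k hk'
            · obtain ⟨k, hkr⟩ := k
              obtain rfl : k = N := by simp only at hk hk'; omega
              simp only [Function.update_self]
              exact ⟨hyP, hyact⟩
      obtain ⟨Z, h0, h1, -, hZ⟩ := key r le_rfl
      obtain ⟨x, hx⟩ := exists_shiftedBlock_eq (r := r) Z h0 h1
      refine ⟨x, mem_deformedProduct_iff.2 fun k => ?_, slice_injective (funext fun k => ?_)⟩
      · rw [hx _ (by omega), hx _ (by omega), hx _ (by omega)]
        exact (hZ k k.2).1
      · rw [slice_active, hx _ (by omega), hx _ (by omega), hx _ (by omega)]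
        exact (hZ k k.2).2
    · rintro ⟨x, hx, rfl⟩ k
      rw [slice_active, ← (h M hM k _ _ (hbound x hx _) (hbound x hx _)).1]
      exact ⟨_, mem_deformedProduct_iff.1 hx k, rfl⟩

/-! ### Dimensions of faces -/

theorem empty_mem_activeSets {n : ℕ} (heven : Even n) {ε : ℝ} (hε : 0 < ε) :
    ∅ ∈ activeSets (rowV n ε) (rhs n ε) := by
  have h : ∀ i, slack n ε 0 i = 1 := by intro i; unfold slack; split_ifs <;> simp
  refine ⟨0, (mem_polygon_iff heven hε).2 fun i _ => by rw [h]; exact zero_le_one, ?_⟩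
  ext i
  simp [mem_active_iff heven hε, h]

/-- A bounded polyhedron with an interior point is a full-dimensional polytope. -/
theorem isPolytope_polyhedron {ι E : Type*} [Finite ι] [NormedAddCommGroup E] [NormedSpace ℝ E]
    [FiniteDimensional ℝ E] {a : ι → E →ₗ[ℝ] ℝ} {b : ι → ℝ}
    (hb : Bornology.IsBounded (polyhedron a b)) (h : ∅ ∈ activeSets a b) :
    IsPolytope (Module.finrank ℝ E) (polyhedron a b) := by
  obtain ⟨x, hx, hact⟩ := h
  refine ⟨⟨_, finite_extremePoints a b, polyhedron_eq_convexHull_extremePoints hb⟩, ⟨x, hx⟩, ?_⟩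
  have htop : vectorSpan ℝ (polyhedron a b) = ⊤ := by
    rw [eq_top_iff]
    intro d _
    have h1 := mem_vectorSpan_face hx (d := d) (by simp [hact])
    exact vectorSpan_mono ℝ (fun y hy => hy.1) h1
  rw [dim, htop, finrank_top]

/-- The dimension of a face is at least the codimension of its tight inequalities. -/
theorem finrank_le_dim_face_add {ι E : Type*} [Finite ι] [NormedAddCommGroup E]
    [NormedSpace ℝ E] [FiniteDimensional ℝ E] {a : ι → E →ₗ[ℝ] ℝ} {b : ι → ℝ} {x : E}
    (hx : x ∈ polyhedron a b) :
    Module.finrank ℝ E ≤ dim (face a b (active a b x)) + (active a b x).ncard := by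
  classical
  have := Fintype.ofFinite ι
  let A : E →ₗ[ℝ] (active a b x → ℝ) := LinearMap.pi fun i => a i
  have h1 := A.finrank_range_add_finrank_ker
  have h2 : Module.finrank ℝ (LinearMap.range A) ≤ (active a b x).ncard := by
    refine (Submodule.finrank_le _).trans ?_
    rw [Module.finrank_fintype_fun_eq_card, ← Nat.card_eq_fintype_card, Nat.card_coe_set_eq]
  have h3 : Module.finrank ℝ (LinearMap.ker A) ≤ dim (face a b (active a b x)) := by
    refine Submodule.finrank_mono fun d hd => mem_vectorSpan_face hx fun i hi => ?_
    exact congrFun (LinearMap.mem_ker.1 hd) ⟨i, hi⟩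
  omega

theorem ncard_eq_sum_slice {r n : ℕ} (J : Set (Fin r × Fin n)) :
    J.ncard = ∑ k, (slice J k).ncard := by
  classical
  rw [Set.ncard_eq_toFinset_card' J,
    Finset.card_eq_sum_card_fiberwise (f := Prod.fst) (t := Finset.univ) (by simp [Set.MapsTo])]
  refine Finset.sum_congr rfl fun k _ => ?_
  rw [Set.ncard_eq_toFinset_card' (slice J k)]
  refine Finset.card_bij' (fun ki _ => ki.2) (fun i _ => (k, i)) ?_ ?_ ?_ ?_
  · rintro ⟨k', i⟩ h
    simp only [Finset.mem_filter, Set.mem_toFinset] at h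
    obtain ⟨h, rfl⟩ := h
    exact Set.mem_toFinset.2 h
  · intro i h
    exact Finset.mem_filter.2
      ⟨Set.mem_toFinset.2 (show i ∈ slice J k from Set.mem_toFinset.1 h), rfl⟩
  · rintro ⟨k', i⟩ h
    simp only [Finset.mem_filter] at h
    rw [h.2]
  · intro i h
    rfl

/-- If the slices of `J` have at most two elements and `J` has at least `2r - 1`, then all slices
but one have two elements. -/
theorem exists_forall_not_subsingleton {r n : ℕ} (hr : 2 ≤ r) {J : Set (Fin r × Fin n)}
    (h2 : ∀ k, (slice J k).ncard ≤ 2) (hJ : 2 * r ≤ 1 + J.ncard) :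
    ∃ k₀, ∀ k, k ≠ k₀ → ¬ (slice J k).Subsingleton := by
  classical
  by_contra! hcon
  obtain ⟨k₁, -, hk₁⟩ := hcon ⟨0, by omega⟩
  obtain ⟨k₂, hne, hk₂⟩ := hcon k₁
  have hle : ∀ k, (slice J k).ncard + (if k = k₁ then 1 else 0) + (if k = k₂ then 1 else 0) ≤ 2 := by
    intro k
    have a1 := Set.ncard_le_one_iff_subsingleton.2 hk₁
    have a2 := Set.ncard_le_one_iff_subsingleton.2 hk₂
    by_cases c1 : k = k₁
    · subst c1; simp [hne.symm]; omega
    · by_cases c2 : k = k₂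
      · subst c2; simp [c1]; omega
      · simp [c1, c2, h2 k]
  have hsum := Finset.sum_le_sum fun k (_ : k ∈ Finset.univ) => hle k
  rw [Finset.sum_add_distrib, Finset.sum_add_distrib, ← ncard_eq_sum_slice] at hsum
  simp at hsum
  omega

end ProjectedProducts

open ProjectedProducts in
theorem theorem1 (n r : ℕ) (hn : 4 ≤ n) (heven : Even n) (hr : 2 ≤ r) :
    ∃ ε₀ : ℝ, 0 < ε₀ ∧ ∀ ε : ℝ, 0 < ε → ε < ε₀ → ∃ M₀ : ℝ, ∀ M : ℝ, M₀ < M →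
      ProjectedProducts.IsNGon n (ProjectedProducts.polygon n ε) ∧
      ProjectedProducts.IsPolytope (2 * r) (ProjectedProducts.deformedProduct n r ε M) ∧
      (∀ G : Set (Fin (2 * r) → ℝ),
        IsExposed ℝ (ProjectedProducts.deformedProduct n r ε M) G → G.Nonempty →
        ProjectedProducts.dim G ≤ 1 →
        ProjectedProducts.StrictlyPreserved (ProjectedProducts.lastFour r hr)
          (ProjectedProducts.deformedProduct n r ε M) G) ∧
      ∃ φ : ProjectedProducts.Faces (ProjectedProducts.product n r ε) ≃o
          ProjectedProducts.Faces (ProjectedProducts.deformedProduct n r ε M),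
        (∀ (k : Fin r) (i : Fin n),
          ∃ F : ProjectedProducts.Faces (ProjectedProducts.product n r ε),
            (F : Set (Fin r → Fin 2 → ℝ)) = ProjectedProducts.productFacet n r ε k i ∧
            (φ F : Set (Fin (2 * r) → ℝ)) = ProjectedProducts.deformedFacet n r ε M k i) ∧
        (∀ (k : Fin r) (p : Fin r → Fin 2 → ℝ),
          (∀ j, p j ∈ (ProjectedProducts.polygon n ε).extremePoints ℝ) →
          ∃ F : ProjectedProducts.Faces (ProjectedProducts.product n r ε),
            (F : Set (Fin r → Fin 2 → ℝ)) = ProjectedProducts.productPolygon n r ε k p ∧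
            ProjectedProducts.StrictlyPreserved (ProjectedProducts.lastFour r hr)
              (ProjectedProducts.deformedProduct n r ε M) (φ F : Set (Fin (2 * r) → ℝ))) := by
  have hsmallev : ∀ᶠ ε : ℝ in 𝓝[>] 0, ε * (n : ℝ) ^ 2 < 1 := by
    have hc : Continuous fun ε : ℝ => ε * (n : ℝ) ^ 2 := by fun_prop
    exact (hc.continuousAt.eventually_lt continuousAt_const (by simp)).filter_mono
      nhdsWithin_le_nhds
  obtain ⟨ε₀, hε₀, hsub⟩ := mem_nhdsGT_iff_exists_Ioo_subset.1
    (hsmallev.and (eventually_exists_coeffRow_pos (n := n) heven hr))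
  refine ⟨ε₀, hε₀, fun ε hε hlt => ?_⟩
  obtain ⟨hsmall, hspan⟩ := hsub ⟨hε, hlt⟩
  obtain ⟨M₀, hM₀⟩ := exists_forall_activeSets_eq hn heven r hε hsmall
  refine ⟨M₀, fun M hM => ?_⟩
  obtain ⟨hbdd, hact⟩ := hM₀ M hM
  rw [product_eq_polyhedron, deformedProduct_eq_polyhedron]
  set b : Fin r × Fin n → ℝ := fun ki => rhs n ε ki.2 with hb
  set c : Fin r × Fin n → ℝ := fun ki => M ^ (ki.1 : ℕ) * rhs n ε ki.2 with hcdef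
  -- one even and one odd row in all blocks but one suffice for strict preservation
  have hpres : ∀ (J : Set (Fin r × Fin n)) (k₀ : Fin r), (face (coeffRow n r ε) c J).Nonempty →
      (∀ k, k ≠ k₀ → ∃ i j : Fin n, Even (i : ℕ) ∧ Odd (j : ℕ) ∧ (k, i) ∈ J ∧ (k, j) ∈ J) →
      StrictlyPreserved (lastFour r hr) (polyhedron (coeffRow n r ε) c)
        (face (coeffRow n r ε) c J) := by
    intro J k₀ hne hJ
    have hJ' : ∀ k, ∃ i j : Fin n, Even (i : ℕ) ∧ Odd (j : ℕ) ∧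
        (k ≠ k₀ → (k, i) ∈ J ∧ (k, j) ∈ J) := by
      intro k
      by_cases hk : k = k₀
      · exact ⟨⟨0, by omega⟩, ⟨1, by omega⟩, Even.zero, odd_one, fun h => absurd hk h⟩
      · obtain ⟨i, j, hi, hj, h⟩ := hJ k hk
        exact ⟨i, j, hi, hj, fun _ => h⟩
    choose e o he ho hmem using hJ'
    refine strictlyPreserved_face _ _ _ _ hne fun y hy hy0 => ?_
    obtain ⟨k, hk, h | h⟩ := hspan k₀ y hy hy0 e o he ho
    · exact ⟨_, (hmem k hk).1, h⟩
    · exact ⟨_, (hmem k hk).2, h⟩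
  have hpair : ∀ S ∈ activeSets (rowV n ε) (rhs n ε), ¬ S.Subsingleton →
      ∃ i j : Fin n, Even (i : ℕ) ∧ Odd (j : ℕ) ∧ i ∈ S ∧ j ∈ S := by
    rintro _ ⟨y, hy, rfl⟩ hS
    obtain ⟨i, j, hi, hj, -, hS⟩ := exists_active_eq_pair hn heven hε hsmall hy hS
    exact ⟨i, j, hi, hj, by simp [hS], by simp [hS]⟩
  refine ⟨isNGon_polygon hn heven hε hsmall, ?_, ?_, ?_⟩
  · have h := isPolytope_polyhedron hbdd (by
      rw [← hact, mem_activeSets_product]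
      exact fun k => empty_mem_activeSets heven hε)
    rwa [Module.finrank_fin_fun] at h
  · -- a face of dimension at most one has at least `2r - 1` tight inequalities, at most two per block
    intro G hG hne hdim
    obtain ⟨x, hx, rfl⟩ := exists_eq_face hG hne
    have hslice : ∀ k, slice (active (coeffRow n r ε) c x) k ∈ activeSets (rowV n ε) (rhs n ε) :=
      mem_activeSets_product.1 (hact ▸ ⟨x, hx, rfl⟩)
    obtain ⟨k₀, hk₀⟩ := exists_forall_not_subsingleton hr (J := active (coeffRow n r ε) c x)
      (fun k => by
        obtain ⟨y, hy, hk⟩ := hslice k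
        obtain ⟨i, j, -, -, -, hsub⟩ := exists_active_subset_pair hn heven hε hsmall hy
        rw [← hk]
        exact (Set.ncard_le_ncard hsub).trans ((Set.ncard_insert_le i {j}).trans (by simp)))
      (by
        have h := finrank_le_dim_face_add hx
        rw [Module.finrank_fin_fun] at h
        omega)
    exact hpres _ k₀ hne fun k hk => hpair _ (hslice k) (hk₀ k hk)
  · refine ⟨facesIso hact, fun k i => ?_, fun k p hp => ?_⟩
    · refine ⟨⟨face (productRow n r ε) b {(k, i)}, isExposed_face _ _ _⟩, ?_, ?_⟩
      · ext y
        rw [productFacet, product_eq_polyhedron]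
        simp only [face, Set.singleton_subset_iff]
        rfl
      · rw [facesIso_face hact]
        ext x
        rw [deformedFacet, deformedProduct_eq_polyhedron]
        simp only [face, Set.singleton_subset_iff]
        rfl
    · have hp' : ∀ j, p j ∈ (polyhedron (rowV n ε) (rhs n ε)).extremePoints ℝ := hp
      set J : Set (Fin r × Fin n) := {ji | ji.1 ≠ k ∧ ji.2 ∈ active (rowV n ε) (rhs n ε) (p ji.1)}
        with hJ
      refine ⟨⟨face (productRow n r ε) b J, isExposed_face _ _ _⟩, ?_, ?_⟩
      · ext y
        constructor
        · rintro ⟨hy, hyJ⟩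
          refine ⟨fun i => hy (k, i), fun j hj => ?_⟩
          refine sub_eq_zero.1 (eq_zero_of_mem_extremePoints (hp' j) fun i hi => ?_)
          have h1 : rowV n ε i (y j) = rhs n ε i := hyJ (show (j, i) ∈ J from ⟨hj, hi⟩)
          have h2 : rowV n ε i (p j) = rhs n ε i := hi
          rw [map_sub, h1, h2, sub_self]
        · rintro ⟨hyk, hyp⟩
          refine ⟨fun ji => ?_, fun ji hji => ?_⟩
          · by_cases hj : ji.1 = k
            · have := hyk ji.2
              rw [← hj] at this
              exact this
            · have := (hp' ji.1).1 ji.2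
              rw [← hyp ji.1 hj] at this
              exact this
          · have : rowV n ε ji.2 (p ji.1) = rhs n ε ji.2 := hji.2
            rw [← hyp ji.1 hji.1] at this
            exact this
      · rw [facesIso_face hact]
        refine hpres J k ?_ fun j hj => ?_
        · have hmem : active (productRow n r ε) b p ∈ activeSets (coeffRow n r ε) c :=
            hact ▸ ⟨p, fun ji => (hp' ji.1).1 ji.2, rfl⟩
          obtain ⟨x, hx, hxp⟩ := hmem
          exact ⟨x, hx, hxp ▸ fun ji hji => hji.2⟩
        · obtain ⟨i, i', hi, hi', m1, m2⟩ := hpair _ ⟨p j, (hp' j).1, rfl⟩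
            (not_subsingleton_active_of_mem_extremePoints (hp' j))
          exact ⟨i, i', hi, hi', ⟨hj, m1⟩, ⟨hj, m2⟩⟩
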